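/- All manifolds and maps are $C^\infty$ and finite-dimensional, without boundary. Let $(M,\gamma,J)$ be a Kähler manifold, i.e. a Riemannian manifold with an integrable almost complex structure $J$ (vanishing Nijenhuis tensor), $\gamma(JX,JY)=\gamma(X,Y)$, whose Kähler form $\Omega(X,Y)=\gamma(JX,Y)$ is closed. Let $\iota:N\to M$ be an immersed CR-submanifold: with $\nu N=(TN)^{\perp_\gamma}$, $$TN=(TN\cap J(TN))\oplus(TN\cap J(\nu N))$$ holds at every point of $N$, and the two terms have constant rank. Assume that $N$ is totally umbilical (in particular, $N$ may be totally geodesic): the second fundamental form $b(X,Y)=(\nabla_XY)^{\nu N}$, where $\nabla$ is the Levi-Civita connection of $\gamma$, satisfies $b(X,Y)=\gamma(X,Y)\,\eta$ for all $X,Y\in TN$ and some normal vector field $\eta$ (totally geodesic: $b=0$). Then the induced F structure $F$ of $N$, i.e. the unique field of endomorphisms of $TN$ with $F=J$ on $TN\cap J(TN)$ and $F=0$ on $TN\cap J(\nu N)$, is a classical CRF structure. That is, $F$ is a smooth tensor field with $F^3+F=0$, and $\mathcal F(X,\alpha)=(FX,-\alpha\circ F)$ is a generalized CRF structure on $N$: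 $\mathcal F$ is a smooth endomorphism of $TN\oplus T^*N$, $\mathcal F^3+\mathcal F=0$, $\mathcal F$ is skew-symmetric for the pairing $g((X,\alpha),(Y,\beta))=\frac12(\alpha(Y)+\beta(X))$, and the $i$-eigenbundle of $\mathcal F$ in $(TN\oplus T^*N)\otimes\mathbb C$ is closed under the (complex bilinear) Courant bracket $$[(X,\alpha),(Y,\beta)]=\bigl([X,Y],\;L_X\beta-L_Y\alpha+\tfrac12 d(\alpha(Y)-\beta(X))\bigr).$$ -/

import Mathlib

open Bundle Manifold VectorField
open scoped ContDiff Topology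

set_option linter.unusedSectionVars false

noncomputable section

/-! ## The Levi-Civita connection of a smooth Riemannian manifold -/

section LeviCivita

variable {E : Type*} [NormedAddCommGroup E] [NormedSpace ℝ E] [FiniteDimensional ℝ E]
  {M : Type*} [TopologicalSpace M] [ChartedSpace E M] [IsManifold 𝓘(ℝ, E) ∞ M]
  [RiemannianBundle (fun x : M ↦ TangentSpace 𝓘(ℝ, E) x)]
  [IsContMDiffRiemannianBundle 𝓘(ℝ, E) ∞ E (fun x : M ↦ TangentSpace 𝓘(ℝ, E) x)]

/-- Arbitrary (not necessarily smooth) vector fields on `M`; smoothness is imposed separately. -/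
abbrev VField (E : Type*) [NormedAddCommGroup E] [NormedSpace ℝ E]
    (M : Type*) [TopologicalSpace M] [ChartedSpace E M] := (x : M) → TangentSpace 𝓘(ℝ, E) x

/-- The right-hand side of the Koszul formula; it equals `2 ⟨∇_X Y, Z⟩` for the Levi-Civita
connection `∇`. -/
def koszul (X Y Z : VField E M) (x : M) : ℝ :=
  mvfderiv 𝓘(ℝ, E) (fun y ↦ inner ℝ (Y y) (Z y)) x (X x)
    + mvfderiv 𝓘(ℝ, E) (fun y ↦ inner ℝ (X y) (Z y)) x (Y x)
    - mvfderiv 𝓘(ℝ, E) (fun y ↦ inner ℝ (X y) (Y y)) x (Z x)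
    + inner ℝ (mlieBracket 𝓘(ℝ, E) X Y x) (Z x)
    - inner ℝ (mlieBracket 𝓘(ℝ, E) X Z x) (Y x)
    - inner ℝ (mlieBracket 𝓘(ℝ, E) Y Z x) (X x)

theorem mdiff_inner {X Y : VField E M} {x : M}
    (hX : MDiffAt (T% X) x) (hY : MDiffAt (T% Y) x) : MDiffAt (fun y ↦ inner ℝ (X y) (Y y)) x :=
  MDifferentiableAt.inner_bundle (IB := 𝓘(ℝ, E)) (F := E)
    (E := fun x : M ↦ TangentSpace 𝓘(ℝ, E) x) (b := id) hX hY

theorem mvfderiv_inner_smul_left {f : M → ℝ} {X Y : VField E M} {x : M}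
    (hf : MDiffAt f x) (hX : MDiffAt (T% X) x) (hY : MDiffAt (T% Y) x) (v : TangentSpace 𝓘(ℝ, E) x) :
    mvfderiv 𝓘(ℝ, E) (fun y ↦ inner ℝ ((f • X) y) (Y y)) x v =
      f x * mvfderiv 𝓘(ℝ, E) (fun y ↦ inner ℝ (X y) (Y y)) x v
        + inner ℝ (X x) (Y x) * mvfderiv 𝓘(ℝ, E) f x v := by
  have : (fun y ↦ inner ℝ ((f • X) y) (Y y)) = f * (fun y ↦ inner ℝ (X y) (Y y)) := by
    ext y; simp [inner_smul_left]
  rw [this, mvfderiv_mul hf (mdiff_inner hX hY)]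
  simp

theorem mvfderiv_inner_add_left {X X' Y : VField E M} {x : M}
    (hX : MDiffAt (T% X) x) (hX' : MDiffAt (T% X') x)
    (hY : MDiffAt (T% Y) x) (v : TangentSpace 𝓘(ℝ, E) x) :
    mvfderiv 𝓘(ℝ, E) (fun y ↦ inner ℝ ((X + X') y) (Y y)) x v =
      mvfderiv 𝓘(ℝ, E) (fun y ↦ inner ℝ (X y) (Y y)) x v
        + mvfderiv 𝓘(ℝ, E) (fun y ↦ inner ℝ (X' y) (Y y)) x v := by
  have : (fun y ↦ inner ℝ ((X + X') y) (Y y)) =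
      (fun y ↦ inner ℝ (X y) (Y y)) + (fun y ↦ inner ℝ (X' y) (Y y)) := by
    ext y; simp [inner_add_left]
  rw [this, mvfderiv_add (mdiff_inner hX hY) (mdiff_inner hX' hY)]
  simp

theorem inner_fun_comm (X Y : VField E M) :
    (fun y ↦ inner ℝ (X y) (Y y)) = fun y ↦ inner ℝ (Y y) (X y) := by
  ext y; exact real_inner_comm _ _

theorem koszul_tensorial_left {Y Z : VField E M} {x : M}
    (hY : MDiffAt (T% Y) x) (hZ : MDiffAt (T% Z) x) :
    TensorialAt 𝓘(ℝ, E) E (fun X ↦ koszul X Y Z x) x where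
  smul {f X} hf hX := by
    simp only [koszul, mvfderiv_inner_smul_left hf hX hY, mvfderiv_inner_smul_left hf hX hZ,
      mlieBracket_smul_left hf hX]
    simp [inner_add_left, inner_smul_left, inner_smul_right, real_inner_comm]
    ring
  add {X X'} hX hX' := by
    simp only [koszul, mvfderiv_inner_add_left hX hX' hY, mvfderiv_inner_add_left hX hX' hZ,
      mlieBracket_add_left hX hX']
    simp [inner_add_left, inner_add_right]
    ring

theorem koszul_tensorial_right {X Y : VField E M} {x : M}
    (hX : MDiffAt (T% X) x) (hY : MDiffAt (T% Y) x) :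
    TensorialAt 𝓘(ℝ, E) E (fun Z ↦ koszul X Y Z x) x where
  smul {f Z} hf hZ := by
    simp only [koszul, inner_fun_comm Y (f • Z), inner_fun_comm X (f • Z),
      mvfderiv_inner_smul_left hf hZ hX, mvfderiv_inner_smul_left hf hZ hY,
      mlieBracket_smul_right hf hZ, inner_fun_comm Z]
    simp [inner_add_left, inner_smul_left, inner_smul_right, real_inner_comm]
    ring
  add {Z Z'} hZ hZ' := by
    simp only [koszul, inner_fun_comm Y (Z + Z'), inner_fun_comm X (Z + Z'),
      mvfderiv_inner_add_left hZ hZ' hX, mvfderiv_inner_add_left hZ hZ' hY,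
      mlieBracket_add_right hZ hZ', inner_fun_comm Z, inner_fun_comm Z']
    simp [inner_add_left, inner_add_right]
    ring

theorem koszul_add {X Y Y' Z : VField E M} {x : M}
    (hX : MDiffAt (T% X) x) (hY : MDiffAt (T% Y) x) (hY' : MDiffAt (T% Y') x)
    (hZ : MDiffAt (T% Z) x) :
    koszul X (Y + Y') Z x = koszul X Y Z x + koszul X Y' Z x := by
  simp only [koszul, inner_fun_comm X (Y + Y'), mvfderiv_inner_add_left hY hY' hZ,
    mvfderiv_inner_add_left hY hY' hX, mlieBracket_add_left hY hY',
    mlieBracket_add_right hY hY', inner_fun_comm Y X, inner_fun_comm Y' X]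
  simp [inner_add_left, inner_add_right]
  ring

theorem koszul_leibniz {f : M → ℝ} {X Y Z : VField E M} {x : M} (hf : MDiffAt f x)
    (hX : MDiffAt (T% X) x) (hY : MDiffAt (T% Y) x) (hZ : MDiffAt (T% Z) x) :
    koszul X (f • Y) Z x =
      f x * koszul X Y Z x + 2 * (mvfderiv 𝓘(ℝ, E) f x (X x) * inner ℝ (Y x) (Z x)) := by
  simp only [koszul, inner_fun_comm X (f • Y), mvfderiv_inner_smul_left hf hY hZ,
    mvfderiv_inner_smul_left hf hY hX, mlieBracket_smul_left hf hY,
    mlieBracket_smul_right hf hY, inner_fun_comm Y X]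
  simp [inner_add_left, inner_smul_left, inner_smul_right, real_inner_comm]
  ring

/-- There is a torsion-free connection compatible with the Riemannian metric. -/
theorem exists_leviCivita :
    ∃ cov : CovariantDerivative 𝓘(ℝ, E) E (TangentSpace 𝓘(ℝ, E) : M → Type _),
      cov.torsion = 0 ∧ cov.IsMetricCompatible := by
  classical
  have key : ∀ (Y : VField E M) (x : M), ∃ A : TangentSpace 𝓘(ℝ, E) x →L[ℝ] TangentSpace 𝓘(ℝ, E) x,
      MDiffAt (T% Y) x → ∀ X Z : VField E M, MDiffAt (T% X) x → MDiffAt (T% Z) x →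
        2 * inner ℝ (A (X x)) (Z x) = koszul X Y Z x := by
    intro Y x
    by_cases hY : MDiffAt (T% Y) x
    · have : FiniteDimensional ℝ (TangentSpace 𝓘(ℝ, E) x) := inferInstanceAs (FiniteDimensional ℝ E)
      have : CompleteSpace (TangentSpace 𝓘(ℝ, E) x) := FiniteDimensional.complete ℝ _
      let B := TensorialAt.mkHom₂ (I := 𝓘(ℝ, E)) (F := E) (F' := E) (fun X Z ↦ koszul X Y Z x) x
        (fun Z hZ ↦ koszul_tensorial_left hY hZ) (fun X hX ↦ koszul_tensorial_right hX hY)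
      let A : TangentSpace 𝓘(ℝ, E) x →L[ℝ] TangentSpace 𝓘(ℝ, E) x :=
        (InnerProductSpace.toDual ℝ (TangentSpace 𝓘(ℝ, E) x)).symm.toContinuousLinearEquiv.toContinuousLinearMap ∘L B
      refine ⟨(1/2 : ℝ) • A, fun _ X Z hX hZ ↦ ?_⟩
      have hA : inner ℝ (A (X x)) (Z x) = B (X x) (Z x) := by
        simp [A]
      have hB : B (X x) (Z x) = koszul X Y Z x := 
        TensorialAt.mkHom₂_apply _ _ hX hZ
      simp [inner_smul_left, hA, hB]
    · exact ⟨0, fun h ↦ absurd h hY⟩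
  choose A hA using key
  have ext_iff : ∀ (x : M) (S T : TangentSpace 𝓘(ℝ, E) x →L[ℝ] TangentSpace 𝓘(ℝ, E) x),
      (∀ X Z : VField E M, MDiffAt (T% X) x → MDiffAt (T% Z) x →
        inner ℝ (S (X x)) (Z x) = inner ℝ (T (X x)) (Z x)) → S = T := by
    intro x S T h
    ext v
    refine ext_inner_right ℝ fun w ↦ ?_
    simpa using h (FiberBundle.extend E v) (FiberBundle.extend E w)
      (FiberBundle.mdifferentiableAt_extend ..) (FiberBundle.mdifferentiableAt_extend ..)
  have add_smooth : ∀ {Y Y' : VField E M} {x : M}, MDiffAt (T% Y) x → MDiffAt (T% Y') x →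
      MDiffAt (T% (Y + Y')) x := fun h h' ↦ mdifferentiableAt_add_section h h'
  let cov : CovariantDerivative 𝓘(ℝ, E) E (TangentSpace 𝓘(ℝ, E) : M → Type _) :=
    { toFun := A
      isCovariantDerivativeOnUniv :=
        { add := by
            intro Y Y' x hY hY' _
            refine ext_iff _ _ _ fun X Z hX hZ ↦ ?_
            have h1 := hA _ x (add_smooth hY hY') X Z hX hZ
            have h2 := hA _ x hY X Z hX hZ
            have h3 := hA _ x hY' X Z hX hZ
            rw [koszul_add hX hY hY' hZ] at h1
            simp only [add_apply, inner_add_left]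
            linarith
          leibniz := by
            intro Y f x hY hf _
            refine ext_iff _ _ _ fun X Z hX hZ ↦ ?_
            have h1 := hA (f • Y) x (hf.smul_section hY) X Z hX hZ
            have h2 := hA _ x hY X Z hX hZ
            rw [koszul_leibniz hf hX hY hZ] at h1
            rw [← h2] at h1
            simp [inner_add_left, inner_smul_left]
            linarith } }
  have hcov : ∀ {Y X Z : VField E M} {x : M}, MDiffAt (T% Y) x → MDiffAt (T% X) x →
      MDiffAt (T% Z) x → 2 * inner ℝ (cov Y x (X x)) (Z x) = koszul X Y Z x :=
    fun hY hX hZ ↦ hA _ _ hY _ _ hX hZ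
  refine ⟨cov, ?_, ?_⟩
  · rw [CovariantDerivative.torsion_eq_zero_iff]
    intro X Y x hX hY
    refine ext_inner_right ℝ fun w ↦ ?_
    have hw : MDiffAt (T% (FiberBundle.extend E w : VField E M)) x := FiberBundle.mdifferentiableAt_extend ..
    have h1 := hcov hY hX hw
    have h2 := hcov hX hY hw
    have e1 := mlieBracket_swap_apply (I := 𝓘(ℝ, E)) (V := Y) (W := X) (x := x)
    simp only [koszul, FiberBundle.extend_apply_self, e1, inner_fun_comm Y X, inner_neg_left] at h1 h2
    rw [inner_sub_left]
    linarith
  · rw [CovariantDerivative.isMetricCompatible_iff]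
    intro x X Y Z hX hY hZ
    have h1 := hcov hY hX hZ
    have h2 := hcov hZ hX hY
    have e1 := mlieBracket_swap_apply (I := 𝓘(ℝ, E)) (V := Z) (W := Y) (x := x)
    simp only [koszul, e1, inner_fun_comm Z Y, inner_neg_left] at h1 h2
    have e2 : inner ℝ (Y x) (cov Z x (X x)) = inner ℝ (cov Z x (X x)) (Y x) := real_inner_comm _ _
    change _ = inner ℝ (cov Y x (X x)) (Z x) + inner ℝ (Y x) (cov Z x (X x))
    rw [e2]
    linarith

variable (E M) in
/-- The Levi-Civita connection: `leviCivita E M Y x v` is `∇_v Y` at `x`, for `Y` differentiable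
at `x`. -/
def leviCivita : CovariantDerivative 𝓘(ℝ, E) E (TangentSpace 𝓘(ℝ, E) : M → Type _) :=
  exists_leviCivita.choose

theorem leviCivita_torsion : (leviCivita E M).torsion = 0 :=
  exists_leviCivita.choose_spec.1

theorem leviCivita_isMetricCompatible :
    CovariantDerivative.IsMetricCompatible (V := fun x : M ↦ TangentSpace 𝓘(ℝ, E) x)
      (leviCivita E M) :=
  exists_leviCivita.choose_spec.2

/-- The two defining properties determine `∇_X Y`. -/
theorem two_inner_eq_koszul
    (cov : CovariantDerivative 𝓘(ℝ, E) E (TangentSpace 𝓘(ℝ, E) : M → Type _))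
    (htor : cov.torsion = 0)
    (hmet : CovariantDerivative.IsMetricCompatible (V := fun x : M ↦ TangentSpace 𝓘(ℝ, E) x) cov)
    {X Y Z : VField E M} {x : M}
    (hX : MDiffAt (T% X) x) (hY : MDiffAt (T% Y) x) (hZ : MDiffAt (T% Z) x) :
    2 * inner ℝ (cov Y x (X x)) (Z x) = koszul X Y Z x := by
  rw [CovariantDerivative.torsion_eq_zero_iff] at htor
  have m1 : _ = inner ℝ (cov Y x (X x)) (Z x) + inner ℝ (Y x) (cov Z x (X x)) :=
    hmet.mvfderiv_inner_eq X hY hZ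
  have m2 : _ = inner ℝ (cov X x (Y x)) (Z x) + inner ℝ (X x) (cov Z x (Y x)) :=
    hmet.mvfderiv_inner_eq Y hX hZ
  have m3 : _ = inner ℝ (cov X x (Z x)) (Y x) + inner ℝ (X x) (cov Y x (Z x)) :=
    hmet.mvfderiv_inner_eq Z hX hY
  simp only [koszul, m1, m2, m3, ← htor hX hY, ← htor hX hZ, ← htor hY hZ, inner_sub_left,
    inner_sub_right, real_inner_comm (X x), real_inner_comm (Y x)]
  ring

end LeviCivita

/-! ## Kähler manifolds -/

section Kaehler

variable {E : Type*} [NormedAddCommGroup E] [NormedSpace ℝ E]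
  {M : Type*} [TopologicalSpace M] [ChartedSpace E M] [IsManifold 𝓘(ℝ, E) ∞ M]

/-- `X` is smooth at `x`. -/
def SmoothFieldAt (X : VField E M) (x : M) : Prop :=
  ContMDiffAt 𝓘(ℝ, E) 𝓘(ℝ, E).tangent ∞
    (fun y ↦ (⟨y, X y⟩ : TangentBundle 𝓘(ℝ, E) M)) x

variable (E M) in
/-- Fields of endomorphisms of the tangent spaces. -/
abbrev EndoField := (x : M) → TangentSpace 𝓘(ℝ, E) x →L[ℝ] TangentSpace 𝓘(ℝ, E) x

/-- A field of endomorphisms is a smooth tensor field of type `(1,1)` if it maps smooth vector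
fields to smooth vector fields. -/
def IsSmoothEndo (A : EndoField E M) : Prop :=
  ∀ (x : M) (X : VField E M), SmoothFieldAt X x → SmoothFieldAt (fun y ↦ A y (X y)) x

/-- The Nijenhuis tensor `[JX, JY] - [X, Y] - J[JX, Y] - J[X, JY]` of an almost complex
structure. -/
def nijenhuis (J : EndoField E M) (X Y : VField E M) (x : M) : TangentSpace 𝓘(ℝ, E) x :=
  mlieBracket 𝓘(ℝ, E) (fun y ↦ J y (X y)) (fun y ↦ J y (Y y)) x
    - mlieBracket 𝓘(ℝ, E) X Y x
    - J x (mlieBracket 𝓘(ℝ, E) (fun y ↦ J y (X y)) Y x)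
    - J x (mlieBracket 𝓘(ℝ, E) X (fun y ↦ J y (Y y)) x)

/-- The value on three vector fields of the exterior differential of a 2-form `θ`. -/
def extDerivTwoForm (θ : (x : M) → TangentSpace 𝓘(ℝ, E) x → TangentSpace 𝓘(ℝ, E) x → ℝ)
    (X Y Z : VField E M) (x : M) : ℝ :=
  mvfderiv 𝓘(ℝ, E) (fun y ↦ θ y (Y y) (Z y)) x (X x)
    - mvfderiv 𝓘(ℝ, E) (fun y ↦ θ y (X y) (Z y)) x (Y x)
    + mvfderiv 𝓘(ℝ, E) (fun y ↦ θ y (X y) (Y y)) x (Z x)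
    - θ x (mlieBracket 𝓘(ℝ, E) X Y x) (Z x)
    + θ x (mlieBracket 𝓘(ℝ, E) X Z x) (Y x)
    - θ x (mlieBracket 𝓘(ℝ, E) Y Z x) (X x)

variable [RiemannianBundle (fun x : M ↦ TangentSpace 𝓘(ℝ, E) x)]

/-- The Kähler form `Ω(v, w) = γ(J v, w)`. -/
def kaehlerForm (J : EndoField E M) (x : M) (v w : TangentSpace 𝓘(ℝ, E) x) : ℝ :=
  inner ℝ (J x v) w

/-- `J` is a Kähler structure on the Riemannian manifold `M`: an integrable almost complex
structure, orthogonal for the metric, whose Kähler form is closed. -/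
structure IsKaehler (J : EndoField E M) : Prop where
  smooth : IsSmoothEndo J
  sq_eq_neg : ∀ (x : M) (v : TangentSpace 𝓘(ℝ, E) x), J x (J x v) = -v
  orthogonal : ∀ (x : M) (v w : TangentSpace 𝓘(ℝ, E) x), inner ℝ (J x v) (J x w) = inner ℝ v w
  integrable : ∀ (x : M) (X Y : VField E M), SmoothFieldAt X x → SmoothFieldAt Y x →
    nijenhuis J X Y x = 0
  closed : ∀ (x : M) (X Y Z : VField E M), SmoothFieldAt X x → SmoothFieldAt Y x →
    SmoothFieldAt Z x → extDerivTwoForm (kaehlerForm J) X Y Z x = 0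

end Kaehler

/-! ## Submanifolds -/

section Submanifold

variable {E : Type*} [NormedAddCommGroup E] [NormedSpace ℝ E]
  {M : Type*} [TopologicalSpace M] [ChartedSpace E M]
  {E' : Type*} [NormedAddCommGroup E'] [NormedSpace ℝ E']
  {N : Type*} [TopologicalSpace N] [ChartedSpace E' N]

/-- The differential of `ι : N → M` at `x`. -/
abbrev diffAt (ι : N → M) (x : N) :
    TangentSpace 𝓘(ℝ, E') x →L[ℝ] TangentSpace 𝓘(ℝ, E) (ι x) :=
  mfderiv 𝓘(ℝ, E') 𝓘(ℝ, E) ι x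

/-- The tangent space of the submanifold, as a subspace of the tangent space of `M`. -/
def tangentSub (ι : N → M) (x : N) : Submodule ℝ (TangentSpace 𝓘(ℝ, E) (ι x)) :=
  LinearMap.range (diffAt (E := E) (E' := E') ι x).toLinearMap

variable [RiemannianBundle (fun x : M ↦ TangentSpace 𝓘(ℝ, E) x)]

/-- The normal space of the submanifold. -/
def normalSub (ι : N → M) (x : N) : Submodule ℝ (TangentSpace 𝓘(ℝ, E) (ι x)) :=
  (tangentSub (E' := E') ι x)ᗮ

/-- `TN ∩ J(TN)`. -/
def holomorphicPart (J : EndoField E M) (ι : N → M) (x : N) :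
    Submodule ℝ (TangentSpace 𝓘(ℝ, E) (ι x)) :=
  tangentSub (E' := E') ι x ⊓ (tangentSub (E' := E') ι x).map (J (ι x)).toLinearMap

/-- `TN ∩ J(νN)`. -/
def totallyRealPart (J : EndoField E M) (ι : N → M) (x : N) :
    Submodule ℝ (TangentSpace 𝓘(ℝ, E) (ι x)) :=
  tangentSub (E' := E') ι x ⊓ (normalSub (E' := E') ι x).map (J (ι x)).toLinearMap

/-- `TN = (TN ∩ J(TN)) ⊕ (TN ∩ J(νN))` at every point of `N`, with terms of constant rank. -/
structure IsCRSubmanifold (J : EndoField E M) (ι : N → M) : Prop where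
  disjoint : ∀ x : N,
    Disjoint (holomorphicPart (E' := E') J ι x) (totallyRealPart (E' := E') J ι x)
  sup_eq : ∀ x : N,
    holomorphicPart (E' := E') J ι x ⊔ totallyRealPart (E' := E') J ι x = tangentSub (E' := E') ι x
  rank_holomorphicPart : ∃ p : ℕ, ∀ x : N,
    Module.finrank ℝ (holomorphicPart (E' := E') J ι x) = p
  rank_totallyRealPart : ∃ q : ℕ, ∀ x : N,
    Module.finrank ℝ (totallyRealPart (E' := E') J ι x) = q

/-- `F` is the structure induced on the CR-submanifold: it is `J` on `TN ∩ J(TN)` and `0` on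
`TN ∩ J(νN)`. -/
structure IsInducedFStructure (J : EndoField E M) (ι : N → M) (F : EndoField E' N) : Prop where
  eq_J : ∀ (x : N) (v : TangentSpace 𝓘(ℝ, E') x),
    diffAt (E := E) ι x v ∈ holomorphicPart (E' := E') J ι x →
      diffAt (E := E) ι x (F x v) = J (ι x) (diffAt ι x v)
  eq_zero : ∀ (x : N) (v : TangentSpace 𝓘(ℝ, E') x),
    diffAt (E := E) ι x v ∈ totallyRealPart (E' := E') J ι x → F x v = 0

variable [IsManifold 𝓘(ℝ, E) ∞ M] [IsManifold 𝓘(ℝ, E') ∞ N]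

/-- `Y'` is a local extension to `M`, near `ι x`, of the vector field `Y` on `N`, both being
smooth. -/
structure IsLocalExtension (ι : N → M) (x : N) (Y : VField E' N) (Y' : VField E M) : Prop where
  smooth : SmoothFieldAt Y x
  smooth_ext : SmoothFieldAt Y' (ι x)
  related : ∀ᶠ y in 𝓝 x, Y' (ι y) = diffAt ι y (Y y)

variable [FiniteDimensional ℝ E]
  [IsContMDiffRiemannianBundle 𝓘(ℝ, E) ∞ E (fun x : M ↦ TangentSpace 𝓘(ℝ, E) x)]

/-- The second fundamental form `b(v, Y)` of the submanifold, given by the Gauss formula as the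
normal component of `∇_v Y'`, where `v` is tangent to `N` at `x` and `Y'` is a local extension to
`M` of the vector field `Y` on `N`. -/
def secondFundamentalForm (ι : N → M) (x : N) (v : TangentSpace 𝓘(ℝ, E') x) (Y' : VField E M) :
    TangentSpace 𝓘(ℝ, E) (ι x) :=
  haveI : FiniteDimensional ℝ (TangentSpace 𝓘(ℝ, E) (ι x)) :=
    inferInstanceAs (FiniteDimensional ℝ E)
  (normalSub (E' := E') ι x).starProjection (leviCivita E M Y' (ι x) (diffAt ι x v))

variable (E E') in
/-- `b(v, Y) = γ(v, Y) η` for some normal vector field `η`. -/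
def IsTotallyUmbilical (ι : N → M) : Prop :=
  ∃ η : (x : N) → TangentSpace 𝓘(ℝ, E) (ι x), (∀ x, η x ∈ normalSub (E' := E') ι x) ∧
    ∀ (x : N) (v : TangentSpace 𝓘(ℝ, E') x) (Y : VField E' N) (Y' : VField E M),
      IsLocalExtension ι x Y Y' →
        secondFundamentalForm ι x v Y' =
          (inner ℝ (diffAt (E := E) ι x v) (diffAt ι x (Y x)) : ℝ) • η x

variable (E E') in
/-- The second fundamental form vanishes. -/
def IsTotallyGeodesic (ι : N → M) : Prop :=
  ∀ (x : N) (v : TangentSpace 𝓘(ℝ, E') x) (Y : VField E' N) (Y' : VField E M),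
    IsLocalExtension ι x Y Y' → secondFundamentalForm ι x v Y' = 0

end Submanifold

/-! ## The Courant bracket and classical CRF structures -/

section Courant

variable {E : Type*} [NormedAddCommGroup E] [NormedSpace ℝ E] [FiniteDimensional ℝ E]
  {N : Type*} [TopologicalSpace N] [ChartedSpace E N] [IsManifold 𝓘(ℝ, E) ∞ N]

/-- The cotangent space at `x`. -/
abbrev Covec (E : Type*) [NormedAddCommGroup E] [NormedSpace ℝ E] {N : Type*}
    [TopologicalSpace N] [ChartedSpace E N] (x : N) := TangentSpace 𝓘(ℝ, E) x →L[ℝ] ℝ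

/-- The fibre `T_x N ⊕ T*_x N` of the big tangent bundle. -/
abbrev BigTangent (E : Type*) [NormedAddCommGroup E] [NormedSpace ℝ E] {N : Type*}
    [TopologicalSpace N] [ChartedSpace E N] (x : N) := TangentSpace 𝓘(ℝ, E) x × Covec E x

variable (E N) in
/-- Arbitrary sections of the big tangent bundle. -/
abbrev BigSection := (x : N) → BigTangent E x

/-- A 1-form is smooth at `x` if its values on the vector fields that are smooth at `x` are. -/
def SmoothFormAt (α : (x : N) → Covec E x) (x : N) : Prop :=
  ∀ Z : VField E N, SmoothFieldAt Z x →
    ContMDiffAt 𝓘(ℝ, E) 𝓘(ℝ, ℝ) ∞ (fun y ↦ α y (Z y)) x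

/-- Smoothness of a section `(X, α)` of the big tangent bundle. -/
def SmoothBigAt (s : BigSection E N) (x : N) : Prop :=
  SmoothFieldAt (fun y ↦ (s y).1) x ∧ SmoothFormAt (fun y ↦ (s y).2) x

/-- The value `(L_X β)(Z) = X(β(Z)) - β([X, Z])` of a Lie derivative on a vector field. -/
def lieDerivFormOn (X : VField E N) (β : (x : N) → Covec E x) (x : N) (Z : VField E N) : ℝ :=
  mvfderiv 𝓘(ℝ, E) (fun y ↦ β y (Z y)) x (X x) - β x (mlieBracket 𝓘(ℝ, E) X Z x)

theorem SmoothFieldAt.mdiff {X : VField E N} {x : N} (h : SmoothFieldAt X x) : MDiffAt (T% X) x :=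
  ContMDiffAt.mdifferentiableAt h (by simp)

theorem SmoothFormAt.mdiff_apply {α : (x : N) → Covec E x} {x : N} (hα : SmoothFormAt α x)
    {Z : VField E N} (hZ : MDiffAt (T% Z) x) : MDiffAt (fun y ↦ α y (Z y)) x := by
  let t := trivializationAt E (TangentSpace 𝓘(ℝ, E)) x
  have x_mem : x ∈ t.baseSet := FiberBundle.mem_baseSet_trivializationAt E (TangentSpace 𝓘(ℝ, E)) x
  let b := Module.Basis.ofVectorSpace ℝ E
  let s := t.localFrame b
  let c := t.localFrameCoeff 𝓘(ℝ, E) b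
  have hs (i) : SmoothFieldAt (s i) x := contMDiffAt_localFrame_of_mem ∞ t b i x_mem
  have hc (i) : MDiffAt (LinearMap.piApply (c i) Z) x :=
    mdifferentiableAt_localFrameCoeff b x_mem hZ i
  have h0 : ∀ u : Finset _,
      MDiffAt (fun y ↦ ∑ i ∈ u, LinearMap.piApply (c i) Z y * α y (s i y)) x := by
    classical
    intro u
    induction u using Finset.induction_on with
    | empty => simpa using (mdifferentiableAt_const : MDiffAt (fun _ : N ↦ (0 : ℝ)) x)
    | insert i u hi ih =>
      simp only [Finset.sum_insert hi]
      exact MDifferentiableAt.add ((hc i).mul ((hα _ (hs i)).mdifferentiableAt (by simp))) ih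
  have h1 := h0 Finset.univ
  refine h1.congr_of_eventuallyEq ?_
  filter_upwards [t.eventually_eq_localFrame_sum_coeff_smul (I := 𝓘(ℝ, E)) (s := Z) b x_mem]
    with y hy
  conv_lhs => rw [hy]
  simp [map_sum, s, c]

theorem lieDerivFormOn_tensorial {X : VField E N} {β : (x : N) → Covec E x} {x : N}
    (hβ : SmoothFormAt β x) :
    TensorialAt 𝓘(ℝ, E) E (lieDerivFormOn X β x) x where
  smul {f Z} hf hZ := by
    have : (fun y ↦ β y ((f • Z) y)) = f * (fun y ↦ β y (Z y)) := by ext y; simp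
    simp only [lieDerivFormOn, this, mlieBracket_smul_right hf hZ,
      mvfderiv_mul hf (hβ.mdiff_apply hZ)]
    simp
    ring
  add {Z Z'} hZ hZ' := by
    have : (fun y ↦ β y ((Z + Z') y)) = (fun y ↦ β y (Z y)) + (fun y ↦ β y (Z' y)) := by
      ext y; simp
    simp only [lieDerivFormOn, this, mlieBracket_add_right hZ hZ',
      mvfderiv_add (hβ.mdiff_apply hZ) (hβ.mdiff_apply hZ')]
    simp
    ring

open Classical in
/-- The covector `(L_X β)_x`: the one given by `Z ↦ (L_X β)(Z)(x)`, which is tensorial in `Z` for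
smooth `X` and `β`; the value is irrelevant otherwise. -/
def lieDerivForm (X : VField E N) (β : (x : N) → Covec E x) (x : N) : Covec E x :=
  if h : TensorialAt 𝓘(ℝ, E) E (lieDerivFormOn X β x) x then
    TensorialAt.mkHom (lieDerivFormOn X β x) x h
  else 0

theorem lieDerivForm_apply {X : VField E N} {β : (x : N) → Covec E x} {x : N}
    (hβ : SmoothFormAt β x) {Z : VField E N} (hZ : SmoothFieldAt Z x) :
    lieDerivForm X β x (Z x) =
      mvfderiv 𝓘(ℝ, E) (fun y ↦ β y (Z y)) x (X x) - β x (mlieBracket 𝓘(ℝ, E) X Z x) := by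
  rw [lieDerivForm, dif_pos (lieDerivFormOn_tensorial hβ)]
  exact TensorialAt.mkHom_apply _ hZ.mdiff

/-- The Courant bracket
`[(X, α), (Y, β)] = ([X, Y], L_X β - L_Y α + (1/2) d(α(Y) - β(X)))`. -/
def courantBracket (s t : BigSection E N) : BigSection E N := fun x ↦
  (mlieBracket 𝓘(ℝ, E) (fun y ↦ (s y).1) (fun y ↦ (t y).1) x,
    lieDerivForm (fun y ↦ (s y).1) (fun y ↦ (t y).2) x
      - lieDerivForm (fun y ↦ (t y).1) (fun y ↦ (s y).2) x
      + (1 / 2 : ℝ) • mvfderiv 𝓘(ℝ, E) (fun y ↦ (s y).2 (t y).1 - (t y).2 (s y).1) x)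

/-- The neutral metric `g((X, α), (Y, β)) = (α(Y) + β(X)) / 2`. -/
def pairing {x : N} (s t : BigTangent E x) : ℝ := (s.2 t.1 + t.2 s.1) / 2

variable (E N) in
/-- Fields of endomorphisms of the big tangent bundle. -/
abbrev BigEndo := (x : N) → BigTangent E x →ₗ[ℝ] BigTangent E x

/-- Generalized F structures: smooth, skew-symmetric for the neutral metric, `Φ³ + Φ = 0`. -/
structure IsGeneralizedFStructure (Φ : BigEndo E N) : Prop where
  smooth : ∀ (x : N) (s : BigSection E N), SmoothBigAt s x → SmoothBigAt (fun y ↦ Φ y (s y)) x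
  cube : ∀ (x : N) (s : BigTangent E x), Φ x (Φ x (Φ x s)) + Φ x s = 0
  skew : ∀ (x : N) (s t : BigTangent E x), pairing (Φ x s) t + pairing s (Φ x t) = 0

/-- `a + i b` belongs to the `i`-eigenspace of (the complexification of) `Φ` at `x`, that is
`Φ a + i Φ b = i (a + i b)`. -/
def MemEigen (Φ : BigEndo E N) (x : N) (a b : BigTangent E x) : Prop :=
  Φ x a = -b ∧ Φ x b = a

/-- A generalized CRF structure is a generalized F structure whose `i`-eigenbundle (in the
complexified big tangent bundle) is closed under the complex bilinear extension
`[a + i b, c + i d] = ([a, c] - [b, d]) + i ([a, d] + [b, c])` of the Courant bracket, on local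
smooth sections. -/
structure IsGeneralizedCRF (Φ : BigEndo E N) : Prop where
  isGeneralizedFStructure : IsGeneralizedFStructure Φ
  closed : ∀ (U : Set N), IsOpen U → ∀ a b c d : BigSection E N,
    (∀ x ∈ U, SmoothBigAt a x ∧ SmoothBigAt b x ∧ SmoothBigAt c x ∧ SmoothBigAt d x) →
    (∀ x ∈ U, MemEigen Φ x (a x) (b x) ∧ MemEigen Φ x (c x) (d x)) →
    ∀ x ∈ U, MemEigen Φ x (courantBracket a c x - courantBracket b d x)
      (courantBracket a d x + courantBracket b c x)

/-- The endomorphism `(X, α) ↦ (F X, -α ∘ F)` of the big tangent bundle. -/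
def bigOfEndo (F : EndoField E N) : BigEndo E N := fun x ↦
  { toFun := fun s ↦ (F x s.1, -(s.2.comp (F x)))
    map_add' := fun s t ↦ by
      ext <;> simp
      ring
    map_smul' := fun c s ↦ by ext <;> simp }

/-- A classical CRF structure: a smooth tensor field `F` of type `(1,1)` with `F³ + F = 0` such
that `(X, α) ↦ (F X, -α ∘ F)` is a generalized CRF structure. -/
structure IsClassicalCRF (F : EndoField E N) : Prop where
  smooth : IsSmoothEndo F
  cube : ∀ (x : N) (v : TangentSpace 𝓘(ℝ, E) x), F x (F x (F x v)) + F x v = 0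
  isGeneralizedCRF : IsGeneralizedCRF (bigOfEndo F)

end Courant

end

/-! The structure F is the tangential part of J: Fv is the orthogonal projection of Jv to TN. On H =
TN ∩ J(TN) the vector Jv is already tangent, and on TN ∩ J(νN) it is normal. This description makes
F smooth; moreover F takes values in H, where F² = -1, so F³ + F = 0.

Extend γ and all brackets complex bilinearly. The i-eigensections of the big endomorphism are the
pairs (X, α) with FX = iX and α∘F = -iα. For two of them, (X, α) and (Y, β), the value α(FY) is both
iα(Y) and -iα(Y), so α(Y) = 0, and likewise β(X) = 0: the exact term of the Courant bracket drops
out. It remains to see that F[X, Y] = i[X, Y] and that L_Xβ, like L_Yα, is again an eigenform. The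
first is the integrability of J read along N (`IsTangentialPart.apply_mlieBracket`) and needs no
umbilicity.

For the second, expand (L_Xβ)(FZ) + i(L_Xβ)(Z). The derivative terms cancel, and the claim becomes
β([X, FZ] + i[X, Z]) = 0 for every tangent Z. Write β = γ(B, ·) with B in H ⊗ ℂ and JB = iB. Since
∇J = 0 (`IsKaehler.leviCivita_apply`), the derivatives of X are of type (1,0), as B is, and γ
vanishes on two such vectors; also γ(B, J∇_XZ + i∇_XZ) = 0. Only γ(B, ∇_X n) is left, where n = FZ -
JZ is normal. On a totally umbilical N the tangential part of ∇_X n is a multiple cX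
(`IsTotallyUmbilical.exists_inner_leviCivita_normal`), and γ(B, X) = 0 by type. The real form of
this computation is `inner_mlieBracket_of_isTotallyUmbilical`. -/

noncomputable section

/-! ### Lie brackets as commutators of derivations, and their naturality under smooth maps -/

section BracketRelated

variable {E : Type*} [NormedAddCommGroup E] [NormedSpace ℝ E] [FiniteDimensional ℝ E]
  {M : Type*} [TopologicalSpace M] [ChartedSpace E M] [IsManifold 𝓘(ℝ, E) ∞ M]
  {E' : Type*} [NormedAddCommGroup E'] [NormedSpace ℝ E'] [FiniteDimensional ℝ E']
  {N : Type*} [TopologicalSpace N] [ChartedSpace E' N] [IsManifold 𝓘(ℝ, E') ∞ N]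

/-- The expression in the preferred chart at `x` of the vector field `X`. -/
def fieldInChart (x : M) (X : VField E M) : E → E :=
  mpullbackWithin 𝓘(ℝ, E) 𝓘(ℝ, E) (extChartAt 𝓘(ℝ, E) x).symm X (Set.range 𝓘(ℝ, E))

theorem differentiableAt_fieldInChart {X : VField E M} {x : M} (hX : MDiffAt (T% X) x) :
    DifferentiableAt ℝ (fieldInChart x X) (extChartAt 𝓘(ℝ, E) x x) := by
  have : CompleteSpace E := FiniteDimensional.complete ℝ E
  have : IsManifold 𝓘(ℝ, E) 2 M := IsManifold.of_le (n := ∞) (by norm_cast)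
  have h := MDifferentiableWithinAt.differentiableWithinAt_mpullbackWithin_vectorField
    (I := 𝓘(ℝ, E)) (s := Set.univ) (mdifferentiableWithinAt_univ.2 hX)
  rw [Set.preimage_univ, Set.univ_inter, modelWithCornersSelf_coe, Set.range_id] at h
  rw [fieldInChart, modelWithCornersSelf_coe, Set.range_id]
  exact differentiableWithinAt_univ.1 h

theorem fieldInChart_self (X : VField E M) (x : M) :
    fieldInChart x X (extChartAt 𝓘(ℝ, E) x x) = X x := by
  have : IsManifold 𝓘(ℝ, E) 1 M := IsManifold.of_le (n := ∞) (by norm_cast)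
  have h := mfderivWithin_extChartAt_symm_inverse_apply (I := 𝓘(ℝ, E)) (X x)
  refine Eq.trans ?_ h
  rw [fieldInChart, mpullbackWithin_apply, extChartAt_to_inv]

/-- The preferred chart at `x` has the identity as its differential at its own centre, so no
transport back to the manifold appears. -/
theorem mlieBracket_eq_lieBracket_fieldInChart (X Y : VField E M) (x : M) :
    mlieBracket 𝓘(ℝ, E) X Y x =
      lieBracket ℝ (fieldInChart x X) (fieldInChart x Y) (extChartAt 𝓘(ℝ, E) x x) := by
  have : IsManifold 𝓘(ℝ, E) 1 M := IsManifold.of_le (n := ∞) (by norm_cast)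
  rw [← mlieBracketWithin_univ, mlieBracketWithin_apply, mfderiv_extChartAt_self,
    Set.preimage_univ, Set.univ_inter, modelWithCornersSelf_coe, Set.range_id,
    ]
  refine (congrArg (fun L : E →L[ℝ] E ↦ L _) ContinuousLinearMap.inverse_id).trans ?_
  refine (congrFun lieBracketWithin_univ _).trans ?_
  rw [fieldInChart, fieldInChart, modelWithCornersSelf_coe, Set.range_id]

theorem eventually_mvfderiv_eq_fieldInChart {f : M → ℝ} {x : M} (X : VField E M)
    (hf : ContMDiffAt 𝓘(ℝ, E) 𝓘(ℝ, ℝ) 2 f x) :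
    ∀ᶠ y in 𝓝 x, mvfderiv 𝓘(ℝ, E) f y (X y) =
      fderiv ℝ (f ∘ (extChartAt 𝓘(ℝ, E) x).symm) (extChartAt 𝓘(ℝ, E) x y)
        (fieldInChart x X (extChartAt 𝓘(ℝ, E) x y)) := by
  have : IsManifold 𝓘(ℝ, E) 2 M := IsManifold.of_le (n := ∞) (by norm_cast)
  have : IsManifold 𝓘(ℝ, E) 1 M := IsManifold.of_le (n := ∞) (by norm_cast)
  have hev := (contMDiffAt_iff_contMDiffAt_nhds (n := 2) (by simp)).1 hf
  filter_upwards [hev, extChartAt_source_mem_nhds (I := 𝓘(ℝ, E)) x] with y hy hys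
  have hs := (extChartAt 𝓘(ℝ, E) x).left_inv hys
  have hy' : MDiffAt f ((extChartAt 𝓘(ℝ, E) x).symm (extChartAt 𝓘(ℝ, E) x y)) := by
    rw [hs]; exact hy.mdifferentiableAt (by simp)
  have hsymm : MDifferentiableAt 𝓘(ℝ, E) 𝓘(ℝ, E) (extChartAt 𝓘(ℝ, E) x).symm
      (extChartAt 𝓘(ℝ, E) x y) := by
    have := mdifferentiableWithinAt_extChartAt_symm (I := 𝓘(ℝ, E))
      ((extChartAt 𝓘(ℝ, E) x).map_source hys)
    rwa [modelWithCornersSelf_coe, Set.range_id, mdifferentiableWithinAt_univ] at this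
  have hinv := isInvertible_mfderivWithin_extChartAt_symm (I := 𝓘(ℝ, E))
    ((extChartAt 𝓘(ℝ, E) x).map_source hys)
  rw [modelWithCornersSelf_coe, Set.range_id, mfderivWithin_univ] at hinv
  let v : E := fieldInChart x X (extChartAt 𝓘(ℝ, E) x y)
  have hc := mvfderiv_comp_apply (extChartAt 𝓘(ℝ, E) x y) hy' hsymm v
  have hX : mfderiv 𝓘(ℝ, E) 𝓘(ℝ, E) (extChartAt 𝓘(ℝ, E) x).symm (extChartAt 𝓘(ℝ, E) x y) v =
      X ((extChartAt 𝓘(ℝ, E) x).symm (extChartAt 𝓘(ℝ, E) x y)) := by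
    have h := hinv.self_apply_inverse (X ((extChartAt 𝓘(ℝ, E) x).symm (extChartAt 𝓘(ℝ, E) x y)))
    refine Eq.trans (congrArg _ ?_) h
    simp only [v, fieldInChart, modelWithCornersSelf_coe, Set.range_id]
    rw [mpullbackWithin_apply, mfderivWithin_univ]
  rw [hX, hs, mvfderiv, mfderiv_eq_fderiv] at hc
  exact hc.symm

/-- In the chart, Xf is the C¹ map `fderiv` of f applied to a field differentiable at the centre.
Differentiability of X at the single point `x` is therefore enough for a second derivative there. -/
theorem mdifferentiableAt_mvfderiv_apply {f : M → ℝ} {X Y : VField E M} {x : M}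
    (hf : ContMDiffAt 𝓘(ℝ, E) 𝓘(ℝ, ℝ) 2 f x) (hX : MDiffAt (T% X) x) :
    MDiffAt (fun y ↦ mvfderiv 𝓘(ℝ, E) f y (X y)) x ∧
    mvfderiv 𝓘(ℝ, E) (fun y ↦ mvfderiv 𝓘(ℝ, E) f y (X y)) x (Y x) =
      fderiv ℝ (fun u ↦ fderiv ℝ (f ∘ (extChartAt 𝓘(ℝ, E) x).symm) u (fieldInChart x X u))
        (extChartAt 𝓘(ℝ, E) x x) (Y x) := by
  have : IsManifold 𝓘(ℝ, E) 2 M := IsManifold.of_le (n := ∞) (by norm_cast)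
  have : IsManifold 𝓘(ℝ, E) 1 M := IsManifold.of_le (n := ∞) (by norm_cast)
  have hg : ContDiffAt ℝ 2 (f ∘ (extChartAt 𝓘(ℝ, E) x).symm) (extChartAt 𝓘(ℝ, E) x x) := by
    have := (contMDiffAt_iff.1 hf).2
    rw [modelWithCornersSelf_coe, Set.range_id] at this
    exact this
  have hk : DifferentiableAt ℝ
      (fun u ↦ fderiv ℝ (f ∘ (extChartAt 𝓘(ℝ, E) x).symm) u (fieldInChart x X u))
      (extChartAt 𝓘(ℝ, E) x x) :=
    ((hg.fderiv_right (m := 1) (by norm_num)).differentiableAt (by simp)).clm_apply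
      (differentiableAt_fieldInChart hX)
  have hev := eventually_mvfderiv_eq_fieldInChart X hf
  have hφ : MDifferentiableAt 𝓘(ℝ, E) 𝓘(ℝ, E) (extChartAt 𝓘(ℝ, E) x) x :=
    mdifferentiableAt_extChartAt (mem_chart_source E x)
  have hk' := hk.mdifferentiableAt
  refine ⟨(hk'.comp x hφ).congr_of_eventuallyEq hev, ?_⟩
  have h1 := mvfderiv_comp_apply x hk' hφ (Y x)
  rw [mfderiv_extChartAt_self] at h1
  have h2 := Filter.EventuallyEq.mfderiv_eq hev (I := 𝓘(ℝ, E)) (I' := 𝓘(ℝ, ℝ))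
  have h3 : mvfderiv 𝓘(ℝ, E) (fun y ↦ mvfderiv 𝓘(ℝ, E) f y (X y)) x (Y x) =
    mvfderiv 𝓘(ℝ, E) ((fun u ↦ fderiv ℝ (f ∘ (extChartAt 𝓘(ℝ, E) x).symm) u (fieldInChart x X u)) ∘
      (extChartAt 𝓘(ℝ, E) x)) x (Y x) := congrArg (fun L : E →L[ℝ] ℝ ↦ L (Y x)) h2
  rw [h3, h1, mvfderiv, mfderiv_eq_fderiv]
  rfl

/-- Differentiation along a Lie bracket is the commutator of the differentiations. -/
theorem mvfderiv_apply_mlieBracket {f : M → ℝ} {X Y : VField E M} {x : M}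
    (hf : ContMDiffAt 𝓘(ℝ, E) 𝓘(ℝ, ℝ) 2 f x)
    (hX : MDiffAt (T% X) x) (hY : MDiffAt (T% Y) x) :
    mvfderiv 𝓘(ℝ, E) f x (mlieBracket 𝓘(ℝ, E) X Y x) =
      mvfderiv 𝓘(ℝ, E) (fun y ↦ mvfderiv 𝓘(ℝ, E) f y (Y y)) x (X x)
        - mvfderiv 𝓘(ℝ, E) (fun y ↦ mvfderiv 𝓘(ℝ, E) f y (X y)) x (Y x) := by
  have hg : ContDiffAt ℝ 2 (f ∘ (extChartAt 𝓘(ℝ, E) x).symm) (extChartAt 𝓘(ℝ, E) x x) := by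
    have := (contMDiffAt_iff.1 hf).2
    rw [modelWithCornersSelf_coe, Set.range_id] at this
    exact this
  have h := fderiv_apply_lieBracket hg (by simp) (differentiableAt_fieldInChart hY)
    (differentiableAt_fieldInChart hX)
  have hev := (eventually_mvfderiv_eq_fieldInChart (mlieBracket 𝓘(ℝ, E) X Y) hf).self_of_nhds
  rw [fieldInChart_self, mlieBracket_eq_lieBracket_fieldInChart] at hev
  rw [(mdifferentiableAt_mvfderiv_apply (Y := X) hf hY).2,
    (mdifferentiableAt_mvfderiv_apply (Y := Y) hf hX).2, mlieBracket_eq_lieBracket_fieldInChart]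
  rw [fieldInChart_self, fieldInChart_self] at h
  exact hev.trans h

/-- Linear functionals composed with the chart at `x` already separate tangent vectors. They are
smooth near `x` only, hence test functions are required to be smooth at the point and not globally.
-/
theorem eq_of_forall_mvfderiv_eq {x : M} {v w : TangentSpace 𝓘(ℝ, E) x}
    (h : ∀ f : M → ℝ, ContMDiffAt 𝓘(ℝ, E) 𝓘(ℝ, ℝ) ∞ f x →
      mvfderiv 𝓘(ℝ, E) f x v = mvfderiv 𝓘(ℝ, E) f x w) : v = w := by
  have : IsManifold 𝓘(ℝ, E) 1 M := IsManifold.of_le (n := ∞) (by norm_cast)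
  have hd : ∀ (ℓ : E →L[ℝ] ℝ) (p u : E), mvfderiv 𝓘(ℝ, E) ℓ p u = ℓ u := by
    intro ℓ p u
    rw [mvfderiv, mfderiv_eq_fderiv, ContinuousLinearMap.fderiv]
    rfl
  have key : ∀ (ℓ : E →L[ℝ] ℝ) (u : TangentSpace 𝓘(ℝ, E) x),
      mvfderiv 𝓘(ℝ, E) (ℓ ∘ extChartAt 𝓘(ℝ, E) x) x u = ℓ u := by
    intro ℓ u
    have hφ : MDifferentiableAt 𝓘(ℝ, E) 𝓘(ℝ, E) (extChartAt 𝓘(ℝ, E) x) x :=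
      mdifferentiableAt_extChartAt (mem_chart_source E x)
    have h1 := mvfderiv_comp_apply x ℓ.differentiableAt.mdifferentiableAt hφ u
    rw [mfderiv_extChartAt_self] at h1
    exact h1.trans (hd ℓ _ _)
  have hE : ∀ ℓ : E →L[ℝ] ℝ, ℓ v = ℓ w := fun ℓ ↦ by
    rw [← key, ← key]
    exact h _ (ℓ.contDiff.contMDiff.contMDiffAt.comp x contMDiffAt_extChartAt)
  exact (SeparatingDual.eq_iff_forall_dual_eq (R := ℝ) (V := E)).2 hE

/-- The Lie bracket is natural with respect to smooth maps. -/
theorem mfderiv_mlieBracket_of_related {ι : N → M} {x : N} {X Y : VField E' N} {X' Y' : VField E M}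
    (hι : ContMDiffAt 𝓘(ℝ, E') 𝓘(ℝ, E) ∞ ι x)
    (hX : MDiffAt (T% X) x) (hY : MDiffAt (T% Y) x)
    (hX' : MDiffAt (T% X') (ι x)) (hY' : MDiffAt (T% Y') (ι x))
    (hXX' : ∀ᶠ y in 𝓝 x, X' (ι y) = diffAt (E := E) ι y (X y))
    (hYY' : ∀ᶠ y in 𝓝 x, Y' (ι y) = diffAt (E := E) ι y (Y y)) :
    diffAt (E := E) ι x (mlieBracket 𝓘(ℝ, E') X Y x) = mlieBracket 𝓘(ℝ, E) X' Y' (ι x) := by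
  have : IsManifold 𝓘(ℝ, E) 2 M := IsManifold.of_le (n := ∞) (by norm_cast)
  have : IsManifold 𝓘(ℝ, E') 2 N := IsManifold.of_le (n := ∞) (by norm_cast)
  have hι1 : MDiffAt ι x := hι.mdifferentiableAt (by simp)
  refine eq_of_forall_mvfderiv_eq fun f hf ↦ ?_
  have hf2 : ContMDiffAt 𝓘(ℝ, E) 𝓘(ℝ, ℝ) 2 f (ι x) := hf.of_le (by norm_cast)
  have hfι : ContMDiffAt 𝓘(ℝ, E') 𝓘(ℝ, ℝ) 2 (f ∘ ι) x := hf2.comp x (hι.of_le (by norm_cast))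
  -- Relatedness gives Z(f∘ι) = (Z'f)∘ι near `x`; the chain rule once more gives WZ(f∘ι) = W'Z'f.
  -- Both brackets are then commutators of matching second derivatives.
  have key : ∀ {Z W : VField E' N} {Z' W' : VField E M}, MDiffAt (T% Z') (ι x) →
      (∀ᶠ y in 𝓝 x, Z' (ι y) = diffAt (E := E) ι y (Z y)) →
      (∀ᶠ y in 𝓝 x, W' (ι y) = diffAt (E := E) ι y (W y)) →
      mvfderiv 𝓘(ℝ, E') (fun y ↦ mvfderiv 𝓘(ℝ, E') (f ∘ ι) y (Z y)) x (W x) =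
        mvfderiv 𝓘(ℝ, E) (fun y ↦ mvfderiv 𝓘(ℝ, E) f y (Z' y)) (ι x) (W' (ι x)) := by
    intro Z W Z' W' hZ' hZ hW
    have h1 := (mdifferentiableAt_mvfderiv_apply (Y := W') hf2 hZ').1
    have e : ∀ᶠ y in 𝓝 x, mvfderiv 𝓘(ℝ, E') (f ∘ ι) y (Z y) =
        ((fun y ↦ mvfderiv 𝓘(ℝ, E) f y (Z' y)) ∘ ι) y := by
      filter_upwards [hZ, hι1.continuousAt.eventually
        ((contMDiffAt_iff_contMDiffAt_nhds (n := 2) (by simp)).1 hf2),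
        (contMDiffAt_iff_contMDiffAt_nhds (n := 2) (by simp)).1 (hι.of_le (by norm_cast))]
        with y hy hfy hιy
      rw [mvfderiv_comp_apply y (hfy.mdifferentiableAt (by simp))
        (hιy.mdifferentiableAt (by simp)), Function.comp_apply, hy]
    have h2 := Filter.EventuallyEq.mfderiv_eq (I := 𝓘(ℝ, E')) (I' := 𝓘(ℝ, ℝ)) e
    have h3 : mvfderiv 𝓘(ℝ, E') (fun y ↦ mvfderiv 𝓘(ℝ, E') (f ∘ ι) y (Z y)) x (W x) =
        mvfderiv 𝓘(ℝ, E') ((fun y ↦ mvfderiv 𝓘(ℝ, E) f y (Z' y)) ∘ ι) x (W x) :=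
      congrArg (fun L : E' →L[ℝ] ℝ ↦ L (W x)) h2
    rw [h3, mvfderiv_comp_apply x h1 hι1, hW.self_of_nhds]
  rw [← mvfderiv_comp_apply x (hf2.mdifferentiableAt (by simp)) hι1,
    mvfderiv_apply_mlieBracket hfι hX hY, mvfderiv_apply_mlieBracket hf2 hX' hY',
    key hY' hYY' hXX', key hX' hXX' hYY']

end BracketRelated

/-! ### Local retractions onto an immersed submanifold and extension of vector fields -/

section LocalExtension

variable {E : Type*} [NormedAddCommGroup E] [NormedSpace ℝ E]
  {M : Type*} [TopologicalSpace M] [ChartedSpace E M] [IsManifold 𝓘(ℝ, E) ∞ M]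
  {E' : Type*} [NormedAddCommGroup E'] [NormedSpace ℝ E']
  {N : Type*} [TopologicalSpace N] [ChartedSpace E' N] [IsManifold 𝓘(ℝ, E') ∞ N]

/-- An immersion has smooth local left inverses. -/
theorem exists_local_leftInverse {ι : N → M} {x : N} (h : IsImmersionAt 𝓘(ℝ, E') 𝓘(ℝ, E) ∞ ι x) :
    ∃ r : M → N, ContMDiffAt 𝓘(ℝ, E) 𝓘(ℝ, E') ∞ r (ι x) ∧ ∀ᶠ y in 𝓝 x, r (ι y) = y := by
  -- In adapted charts the immersion is u ↦ (u, 0), so the projection to the first factor recovers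
  -- u.
  have key : ∀ y ∈ h.domChart.source,
      (h.equiv.symm (h.codChart (ι y))).1 = h.domChart y := by
    intro y hy
    have ht : h.domChart y ∈ (h.domChart.extend 𝓘(ℝ, E')).target := by
      simpa using h.domChart.map_source hy
    have := h.writtenInCharts ht
    simp [h.domChart.left_inv hy] at this
    simp [this]
  refine ⟨fun p ↦ h.domChart.symm (h.equiv.symm (h.codChart p)).1, ?_, ?_⟩
  · have h1 : ContMDiffAt 𝓘(ℝ, E) 𝓘(ℝ, E) ∞ h.codChart (ι x) :=
      contMDiffAt_of_mem_maximalAtlas h.codChart_mem_maximalAtlas h.mem_codChart_source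
    have h2 : ContMDiffAt 𝓘(ℝ, E') 𝓘(ℝ, E') ∞ h.domChart.symm
        ((fun u : E ↦ (h.equiv.symm u).1) (h.codChart (ι x))) := by
      refine contMDiffAt_symm_of_mem_maximalAtlas h.domChart_mem_maximalAtlas ?_
      simp only [key x h.mem_domChart_source]
      exact h.domChart.map_source h.mem_domChart_source
    have h3 : ContMDiffAt 𝓘(ℝ, E) 𝓘(ℝ, E') ∞ (fun u : E ↦ (h.equiv.symm u).1)
        (h.codChart (ι x)) := by
      have : ContDiff ℝ ∞ (fun u : E ↦ (h.equiv.symm u).1) := by fun_prop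
      exact this.contMDiff.contMDiffAt
    have h4 : ContMDiffAt 𝓘(ℝ, E) 𝓘(ℝ, E') ∞ ((fun u : E ↦ (h.equiv.symm u).1) ∘ h.codChart) (ι x) :=
      h3.comp (ι x) h1
    exact h2.comp (ι x) h4
  · filter_upwards [h.domChart.open_source.mem_nhds h.mem_domChart_source] with y hy
    rw [key y hy, h.domChart.left_inv hy]

/-- Differentiate r∘ι = id for a local left inverse r. -/
theorem injective_diffAt {ι : N → M} {x : N} (h : IsImmersionAt 𝓘(ℝ, E') 𝓘(ℝ, E) ∞ ι x) :
    Function.Injective (diffAt (E := E) (E' := E') ι x) := by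
  obtain ⟨r, hr, hrι⟩ := exists_local_leftInverse h
  have h1 := mfderiv_comp x (hr.mdifferentiableAt (by simp)) (h.contMDiffAt.mdifferentiableAt (by simp))
  have h2 : (r ∘ ι) =ᶠ[𝓝 x] id := hrι
  rw [h2.mfderiv_eq, mfderiv_id] at h1
  intro v w hvw
  have h3 := fun u : TangentSpace 𝓘(ℝ, E') x ↦ congrArg (fun L : E' →L[ℝ] E' ↦ L u) h1
  refine (h3 v).trans (Eq.trans ?_ (h3 w).symm)
  exact congrArg (mfderiv 𝓘(ℝ, E) 𝓘(ℝ, E') r (ι x)) hvw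

theorem contMDiffAt_along {ι : N → M} (hι : ContMDiff 𝓘(ℝ, E') 𝓘(ℝ, E) ∞ ι) {x : N}
    {X : VField E' N} (hX : SmoothFieldAt X x) :
    ContMDiffAt 𝓘(ℝ, E') 𝓘(ℝ, E).tangent ∞
      (fun y ↦ (⟨ι y, diffAt (E := E) ι y (X y)⟩ : TangentBundle 𝓘(ℝ, E) M)) x :=
  (hι.contMDiff_tangentMap (m := ∞) (by simp)).contMDiffAt.comp x hX

/-- Smooth vector fields on an immersed submanifold have local extensions. -/
theorem exists_isLocalExtension [RiemannianBundle (fun x : M ↦ TangentSpace 𝓘(ℝ, E) x)]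
    {ι : N → M} (hι : IsImmersion 𝓘(ℝ, E') 𝓘(ℝ, E) ∞ ι) {x : N}
    {X : VField E' N} (hX : SmoothFieldAt X x) : ∃ X' : VField E M, IsLocalExtension ι x X X' := by
  obtain ⟨r, hr, hrι⟩ := exists_local_leftInverse (hι.isImmersionAt x)
  let e := trivializationAt E (TangentSpace 𝓘(ℝ, E) : M → Type _) (ι x)
  have he : ι x ∈ e.baseSet := FiberBundle.mem_baseSet_trivializationAt' (ι x)
  let c : N → E := fun y ↦ (e ⟨ι y, diffAt (E := E) ι y (X y)⟩).2
  have hc : ContMDiffAt 𝓘(ℝ, E') 𝓘(ℝ, E) ∞ c x := by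
    exact (contMDiffAt_totalSpace.1 (contMDiffAt_along hι.contMDiff hX)).2
  have hb : ∀ᶠ p in 𝓝 (ι x), p ∈ e.baseSet := e.open_baseSet.mem_nhds he
  -- In the trivialization, the components of the field along ι are extended to be constant on the
  -- fibres of r.
  refine ⟨fun p ↦ e.symm p (c (r p)), hX, ?_, ?_⟩
  · refine (e.contMDiffAt_section_iff he).2 ?_
    have hcr : ContMDiffAt 𝓘(ℝ, E) 𝓘(ℝ, E) ∞ (c ∘ r) (ι x) := by
      refine ContMDiffAt.comp (ι x) ?_ hr
      rwa [hrι.self_of_nhds]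
    refine hcr.congr_of_eventuallyEq ?_
    filter_upwards [hb] with p hp
    simp [hp]
  · filter_upwards [hrι, hι.contMDiff.continuous.continuousAt.eventually hb] with y hy hyb
    simp only [hy, c]
    exact e.symm_apply_apply_mk hyb _

end LocalExtension

/-! ### The complex structure of a Kähler manifold is parallel -/

section KaehlerConnection

variable {E : Type*} [NormedAddCommGroup E] [NormedSpace ℝ E] [FiniteDimensional ℝ E]
  {M : Type*} [TopologicalSpace M] [ChartedSpace E M] [IsManifold 𝓘(ℝ, E) ∞ M]
  [RiemannianBundle (fun x : M ↦ TangentSpace 𝓘(ℝ, E) x)]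
  [IsContMDiffRiemannianBundle 𝓘(ℝ, E) ∞ E (fun x : M ↦ TangentSpace 𝓘(ℝ, E) x)]

theorem exists_smoothFieldAt {E : Type*} [NormedAddCommGroup E] [NormedSpace ℝ E]
    {M : Type*} [TopologicalSpace M] [ChartedSpace E M] [IsManifold 𝓘(ℝ, E) ∞ M]
    {x : M} (v : TangentSpace 𝓘(ℝ, E) x) :
    ∃ X : VField E M, SmoothFieldAt X x ∧ X x = v :=
  ⟨FiberBundle.extend E v, FiberBundle.contMDiffAt_extend 𝓘(ℝ, E) E v,
    FiberBundle.extend_apply_self ..⟩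

theorem mvfderiv_inner_leviCivita {X Y : VField E M} {x : M} (hX : SmoothFieldAt X x)
    (hY : SmoothFieldAt Y x) (v : TangentSpace 𝓘(ℝ, E) x) :
    mvfderiv 𝓘(ℝ, E) (fun y ↦ inner ℝ (X y) (Y y)) x v =
      inner ℝ (leviCivita E M X x v) (Y x) + inner ℝ (X x) (leviCivita E M Y x v) := by
  obtain ⟨V, hV, rfl⟩ := exists_smoothFieldAt v
  exact leviCivita_isMetricCompatible.mvfderiv_inner_eq V hX.mdiff hY.mdiff

theorem mlieBracket_eq_leviCivita {X Y : VField E M} {x : M} (hX : SmoothFieldAt X x)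
    (hY : SmoothFieldAt Y x) :
    mlieBracket 𝓘(ℝ, E) X Y x = leviCivita E M Y x (X x) - leviCivita E M X x (Y x) :=
  ((CovariantDerivative.torsion_eq_zero_iff _).1 leviCivita_torsion hX.mdiff hY.mdiff).symm

variable {J : EndoField E M}

theorem IsKaehler.inner_left (hJ : IsKaehler J) (x : M) (v w : TangentSpace 𝓘(ℝ, E) x) :
    inner ℝ (J x v) w = -inner ℝ v (J x w) := by
  have h := hJ.orthogonal x v (J x w)
  rw [hJ.sq_eq_neg, inner_neg_right] at h
  linarith

/-- The complex structure of a Kähler manifold is parallel. -/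
theorem IsKaehler.leviCivita_apply (hJ : IsKaehler J) {Y : VField E M} {x : M}
    (hY : SmoothFieldAt Y x) (v : TangentSpace 𝓘(ℝ, E) x) :
    leviCivita E M (fun y ↦ J y (Y y)) x v = J x (leviCivita E M Y x v) := by
  have hneg : ∀ {Z : VField E M}, SmoothFieldAt Z x → ∀ u,
      leviCivita E M (fun y ↦ J y (J y (Z y))) x u = -leviCivita E M Z x u := by
    intro Z hZ u
    have h1 : (fun y ↦ J y (J y (Z y))) = ((-1 : ℝ) • Z : VField E M) := by
      ext y; simp [hJ.sq_eq_neg]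
    rw [h1, (leviCivita E M).isCovariantDerivativeOnUniv.smul_const _ hZ.mdiff]
    simp
  -- A(X, Y, Z) = γ((∇_X J)Y, Z). Metric compatibility makes it skew in Y, Z; J² = -1 lets J move
  -- from Y to Z; dΩ = 0 is the vanishing of its cyclic sum; the Nijenhuis tensor gives one more
  -- linear relation.
  let A : VField E M → VField E M → VField E M → ℝ := fun X Y Z ↦
    inner ℝ (leviCivita E M (fun y ↦ J y (Y y)) x (X x) - J x (leviCivita E M Y x (X x))) (Z x)
  have hJs : ∀ {Z : VField E M}, SmoothFieldAt Z x → SmoothFieldAt (fun y ↦ J y (Z y)) x :=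
    fun hZ ↦ hJ.smooth x _ hZ
  have hskew : ∀ {X Y Z : VField E M}, SmoothFieldAt Y x → SmoothFieldAt Z x →
      A X Y Z = -A X Z Y := by
    intro X Y Z hY hZ
    have h1 := mvfderiv_inner_leviCivita (hJs hY) hZ (X x)
    have h2 := mvfderiv_inner_leviCivita hY (hJs hZ) (X x)
    have h3 : (fun y ↦ inner ℝ (J y (Y y)) (Z y)) = -fun y ↦ inner ℝ (Y y) (J y (Z y)) := by
      ext y; exact hJ.inner_left _ _ _
    rw [h3, mvfderiv_neg] at h1
    have h4 : -mvfderiv 𝓘(ℝ, E) (fun y ↦ inner ℝ (Y y) (J y (Z y))) x (X x) = _ := h1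
    rw [h2] at h4
    simp only [A, inner_sub_left, hJ.inner_left]
    have h5 := real_inner_comm (leviCivita E M Z x (X x)) (J x (Y x))
    have h6 := real_inner_comm (leviCivita E M (fun y ↦ J y (Z y)) x (X x)) (Y x)
    linarith
  have hJ2 : ∀ {X Y Z : VField E M}, SmoothFieldAt Y x →
      A X (fun y ↦ J y (Y y)) Z = A X Y (fun y ↦ J y (Z y)) := by
    intro X Y Z hY
    simp only [A]
    rw [hneg hY]
    simp only [inner_sub_left, hJ.inner_left, inner_neg_left, hJ.sq_eq_neg, inner_neg_right]
    ring
  have hclosed : ∀ {X Y Z : VField E M}, SmoothFieldAt X x → SmoothFieldAt Y x →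
      SmoothFieldAt Z x → A X Y Z + A Y Z X + A Z X Y = 0 := by
    intro X Y Z hX hY hZ
    have h := hJ.closed x X Y Z hX hY hZ
    simp only [extDerivTwoForm, kaehlerForm] at h
    rw [mvfderiv_inner_leviCivita (hJs hY) hZ, mvfderiv_inner_leviCivita (hJs hX) hZ,
      mvfderiv_inner_leviCivita (hJs hX) hY, mlieBracket_eq_leviCivita hX hY,
      mlieBracket_eq_leviCivita hX hZ, mlieBracket_eq_leviCivita hY hZ] at h
    simp only [A, inner_sub_left, map_sub] at h ⊢
    have e : ∀ u v : TangentSpace 𝓘(ℝ, E) x, inner ℝ (J x u) v = -inner ℝ (J x v) u := fun u v ↦ by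
      rw [hJ.inner_left, real_inner_comm]
    have hs := hskew (X := Y) hX hZ
    simp only [A, inner_sub_left] at hs
    linarith [e (Y x) (leviCivita E M Z x (X x)), e (X x) (leviCivita E M Z x (Y x)),
      e (X x) (leviCivita E M Y x (Z x))]
  have hnij : ∀ {X Y Z : VField E M}, SmoothFieldAt X x → SmoothFieldAt Y x →
      A (fun y ↦ J y (X y)) Y Z - A (fun y ↦ J y (Y y)) X Z
        + A X Y (fun y ↦ J y (Z y)) - A Y X (fun y ↦ J y (Z y)) = 0 := by
    intro X Y Z hX hY
    have h := congrArg (fun v ↦ inner ℝ v (Z x)) (hJ.integrable x X Y hX hY)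
    simp only [nijenhuis, mlieBracket_eq_leviCivita hX hY,
      mlieBracket_eq_leviCivita (hJs hX) hY, mlieBracket_eq_leviCivita hX (hJs hY),
      mlieBracket_eq_leviCivita (hJs hX) (hJs hY)] at h
    simp only [map_sub, inner_sub_left, inner_zero_left, hJ.inner_left] at h
    simp only [A, inner_sub_left, hJ.inner_left, hJ.sq_eq_neg, inner_neg_right]
    linarith
  have hA : ∀ {X Y Z : VField E M}, SmoothFieldAt X x → SmoothFieldAt Y x →
      SmoothFieldAt Z x → A X Y Z = 0 := by
    intro X Y Z hX hY hZ
    -- The cyclic identity for (X, JY, JZ) reads A(JY, Z, JX) - A(JZ, Y, JX) = A(X, Y, Z). The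
    -- Nijenhuis relation turns the left side into A(Y, Z, X) + A(Z, X, Y), which is -A(X, Y, Z) by
    -- the cyclic identity for (X, Y, Z). Hence 2A(X, Y, Z) = 0.
    have c1 := hclosed hX hY hZ
    have c2 := hclosed hX (hJs hY) (hJs hZ)
    have n := hnij (Z := fun y ↦ J y (X y)) hY hZ
    have hn : ∀ X Y Z : VField E M, A X Y (fun y ↦ J y (J y (Z y))) = -A X Y Z := fun X Y Z ↦ by
      simp only [A, hJ.sq_eq_neg, inner_neg_right]
    have e1 := hJ2 (X := X) (Z := fun y ↦ J y (Z y)) hY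
    have e2 := hJ2 (X := fun y ↦ J y (Y y)) (Z := X) hZ
    have e3 := hJ2 (X := fun y ↦ J y (Z y)) (Z := X) hY
    have e4 := hskew (X := fun y ↦ J y (Z y)) hX (hJs hY)
    have e5 := hskew (X := Z) hX hY
    rw [hn] at e1 n
    rw [hn] at n
    linarith
  obtain ⟨V, hV, rfl⟩ := exists_smoothFieldAt v
  refine ext_inner_right ℝ fun w ↦ ?_
  obtain ⟨W, hW, rfl⟩ := exists_smoothFieldAt w
  have := hA hV hY hW
  simp only [A, inner_sub_left] at this
  linarith

end KaehlerConnection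

/-! ### Smoothness of tangent fields tested by inner products -/

section SmoothnessCriterion

variable {E : Type*} [NormedAddCommGroup E] [NormedSpace ℝ E]
  {M : Type*} [TopologicalSpace M] [ChartedSpace E M] [IsManifold 𝓘(ℝ, E) ∞ M]
  [RiemannianBundle (fun x : M ↦ TangentSpace 𝓘(ℝ, E) x)]
  [IsContMDiffRiemannianBundle 𝓘(ℝ, E) ∞ E (fun x : M ↦ TangentSpace 𝓘(ℝ, E) x)]
  {E' : Type*} [NormedAddCommGroup E'] [NormedSpace ℝ E'] [FiniteDimensional ℝ E']
  {N : Type*} [TopologicalSpace N] [ChartedSpace E' N] [IsManifold 𝓘(ℝ, E') ∞ N]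

theorem contMDiffAt_matrix_det {n : Type*} [Fintype n] [DecidableEq n] {A : N → Matrix n n ℝ}
    {x : N} (hA : ∀ i j, ContMDiffAt 𝓘(ℝ, E') 𝓘(ℝ, ℝ) ∞ (fun y ↦ A y i j) x) :
    ContMDiffAt 𝓘(ℝ, E') 𝓘(ℝ, ℝ) ∞ (fun y ↦ (A y).det) x := by
  simp only [Matrix.det_apply']
  exact ContMDiffAt.sum fun σ _ ↦ contMDiffAt_const.mul (ContMDiffAt.prod fun i _ ↦ hA _ _)

theorem eq_of_inner_diffAt {ι : N → M} {x : N} (h : Function.Injective (diffAt (E := E) (E' := E') ι x))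
    {v w : TangentSpace 𝓘(ℝ, E') x}
    (hvw : ∀ u : TangentSpace 𝓘(ℝ, E') x,
      (inner ℝ (diffAt (E := E) ι x v) (diffAt (E := E) ι x u) : ℝ) =
        inner ℝ (diffAt (E := E) ι x w) (diffAt (E := E) ι x u)) : v = w := by
  have h1 := hvw (v - w)
  rw [← sub_eq_zero, ← inner_sub_left, ← map_sub, inner_self_eq_zero] at h1
  rw [← map_zero (diffAt (E := E) (E' := E') ι x)] at h1
  exact sub_eq_zero.1 (h h1)

/-- A vector field on an immersed submanifold of a Riemannian manifold is smooth if its inner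
products with smooth vector fields are. -/
theorem smoothFieldAt_of_inner {ι : N → M} (hι : IsImmersion 𝓘(ℝ, E') 𝓘(ℝ, E) ∞ ι)
    {x : N} {Y : VField E' N}
    (hY : ∀ Z : VField E' N, SmoothFieldAt Z x → ContMDiffAt 𝓘(ℝ, E') 𝓘(ℝ, ℝ) ∞
      (fun y ↦ (inner ℝ (diffAt (E := E) ι y (Y y)) (diffAt ι y (Z y)) : ℝ)) x) :
    SmoothFieldAt Y x := by
  classical
  let t := trivializationAt E' (TangentSpace 𝓘(ℝ, E') : N → Type _) x
  have ht : x ∈ t.baseSet := FiberBundle.mem_baseSet_trivializationAt' x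
  let b := Module.finBasis ℝ E'
  let s := t.localFrame b
  have hs (i) : SmoothFieldAt (s i) x := contMDiffAt_localFrame_of_mem ∞ t b i ht
  -- Gram matrix of a local frame for the induced metric. The coefficients of Y solve a linear
  -- system with this matrix and a smooth right-hand side.
  let G : (y : N) → Matrix (Fin (Module.finrank ℝ E')) (Fin (Module.finrank ℝ E')) ℝ := fun y ↦
    Matrix.of fun j i ↦ inner ℝ (diffAt (E := E) ι y (s i y)) (diffAt ι y (s j y))
  let h : (y : N) → Fin (Module.finrank ℝ E') → ℝ := fun y j ↦
    inner ℝ (diffAt (E := E) ι y (Y y)) (diffAt ι y (s j y))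
  have hG : ∀ i j, ContMDiffAt 𝓘(ℝ, E') 𝓘(ℝ, ℝ) ∞ (fun y ↦ G y i j) x := fun j i ↦
    ContMDiffAt.inner_bundle (IB := 𝓘(ℝ, E)) (F := E)
      (E := fun x : M ↦ TangentSpace 𝓘(ℝ, E) x) (b := ι)
      (contMDiffAt_along hι.contMDiff (hs i)) (contMDiffAt_along hι.contMDiff (hs j))
  have hh : ∀ j, ContMDiffAt 𝓘(ℝ, E') 𝓘(ℝ, ℝ) ∞ (fun y ↦ h y j) x := fun j ↦ hY _ (hs j)
  have hsum : ∀ (y : N) (c : Fin (Module.finrank ℝ E') → ℝ) (j),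
      inner ℝ (diffAt (E := E) ι y (∑ i, c i • s i y)) (diffAt ι y (s j y)) =
        (Matrix.mulVec (G y) c) j := by
    intro y c j
    simp only [map_sum, map_smul, sum_inner, inner_smul_left, Matrix.mulVec, dotProduct, G,
      Matrix.of_apply]
    exact Finset.sum_congr rfl fun i _ ↦ mul_comm _ _
  have hframe : ∀ y ∈ t.baseSet, ∀ v w : TangentSpace 𝓘(ℝ, E') y,
      (∀ j, (inner ℝ (diffAt (E := E) ι y v) (diffAt ι y (s j y)) : ℝ) =
        inner ℝ (diffAt (E := E) ι y w) (diffAt ι y (s j y))) → v = w := by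
    intro y hy v w hvw
    refine eq_of_inner_diffAt (injective_diffAt (hι.isImmersionAt y)) fun u ↦ ?_
    rw [← (t.basisAt b hy).sum_repr u]
    simp only [map_sum, map_smul, inner_sum, inner_smul_right]
    refine Finset.sum_congr rfl fun j _ ↦ ?_
    have := hvw j
    simp only [s, t.localFrame_apply_of_mem_baseSet b hy] at this
    rw [this]
  have hdet : ∀ y ∈ t.baseSet, (G y).det ≠ 0 := by
    intro y hy h0
    obtain ⟨c, hc, hGc⟩ := Matrix.exists_mulVec_eq_zero_iff.2 h0
    have h1 : ∑ i, c i • s i y = 0 := by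
      refine hframe y hy _ _ fun j ↦ ?_
      rw [hsum, hGc]
      simp
    simp only [s, t.localFrame_apply_of_mem_baseSet b hy] at h1
    exact hc (funext fun i ↦ Fintype.linearIndependent_iff.1
      (t.basisAt b hy).linearIndependent c h1 i)
  -- Cramer's rule: the solution is a quotient of determinants, hence smooth where the Gram
  -- determinant does not vanish.
  let c : Fin (Module.finrank ℝ E') → N → ℝ := fun i y ↦
    ((G y).updateCol i (h y)).det * ((G y).det)⁻¹
  have hc (i) : ContMDiffAt 𝓘(ℝ, E') 𝓘(ℝ, ℝ) ∞ (c i) x := by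
    refine ContMDiffAt.mul (contMDiffAt_matrix_det fun k l ↦ ?_)
      ((contMDiffAt_matrix_det hG).inv₀ (hdet x ht))
    by_cases hl : l = i
    · subst hl; simpa using hh k
    · simpa [Matrix.updateCol_ne hl] using hG k l
  have hsm : SmoothFieldAt (fun y ↦ ∑ i, (c i • s i) y) x :=
    ContMDiffAt.sum_section fun i _ ↦ (hc i).smul_section (hs i)
  refine hsm.congr_of_eventuallyEq ?_
  filter_upwards [t.open_baseSet.mem_nhds ht] with y hy
  congr 1
  refine hframe y hy _ _ fun j ↦ ?_
  have h1 := hsum y (fun i ↦ c i y) j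
  have h2 : (fun i ↦ c i y) = ((G y).det)⁻¹ • Matrix.cramer (G y) (h y) := by
    ext i
    simp [c, Matrix.cramer_apply, mul_comm]
  rw [h2, Matrix.mulVec_smul, Matrix.mulVec_cramer, smul_smul, inv_mul_cancel₀ (hdet y hy),
    one_smul] at h1
  exact h1.symm

end SmoothnessCriterion

/-! ### The induced F structure as the tangential part of J -/

section InducedFStructure

variable {E : Type*} [NormedAddCommGroup E] [NormedSpace ℝ E] [FiniteDimensional ℝ E]
  {M : Type*} [TopologicalSpace M] [ChartedSpace E M] [IsManifold 𝓘(ℝ, E) ∞ M]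
  [RiemannianBundle (fun x : M ↦ TangentSpace 𝓘(ℝ, E) x)]
  [IsContMDiffRiemannianBundle 𝓘(ℝ, E) ∞ E (fun x : M ↦ TangentSpace 𝓘(ℝ, E) x)]
  {E' : Type*} [NormedAddCommGroup E'] [NormedSpace ℝ E'] [FiniteDimensional ℝ E']
  {N : Type*} [TopologicalSpace N] [ChartedSpace E' N] [IsManifold 𝓘(ℝ, E') ∞ N]
  {J : EndoField E M} {ι : N → M} {F : EndoField E' N}

/-- `F` is the tangential part of `J` on the submanifold. -/
def IsTangentialPart (J : EndoField E M) (ι : N → M) (F : EndoField E' N) : Prop :=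
  ∀ (x : N) (v u : TangentSpace 𝓘(ℝ, E') x),
    (inner ℝ (diffAt (E := E) ι x (F x v)) (diffAt (E := E) ι x u) : ℝ) =
      inner ℝ (J (ι x) (diffAt (E := E) ι x v)) (diffAt (E := E) ι x u)

theorem exists_isTangentialPart (J : EndoField E M)
    (hinj : ∀ x, Function.Injective (diffAt (E := E) (E' := E') ι x)) :
    ∃ F : EndoField E' N, IsTangentialPart J ι F := by
  have key : ∀ x : N, ∃ A : TangentSpace 𝓘(ℝ, E') x →L[ℝ] TangentSpace 𝓘(ℝ, E') x,
      ∀ v u : TangentSpace 𝓘(ℝ, E') x,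
        (inner ℝ (diffAt (E := E) ι x (A v)) (diffAt (E := E) ι x u) : ℝ) =
          inner ℝ (J (ι x) (diffAt (E := E) ι x v)) (diffAt (E := E) ι x u) := by
    intro x
    have : FiniteDimensional ℝ (TangentSpace 𝓘(ℝ, E) (ι x)) :=
      inferInstanceAs (FiniteDimensional ℝ E)
    have : FiniteDimensional ℝ (TangentSpace 𝓘(ℝ, E') x) :=
      inferInstanceAs (FiniteDimensional ℝ E')
    have : T2Space (TangentSpace 𝓘(ℝ, E') x) := inferInstanceAs (T2Space E')
    let D : TangentSpace 𝓘(ℝ, E') x →ₗ[ℝ] TangentSpace 𝓘(ℝ, E) (ι x) := (diffAt (E := E) ι x).toLinearMap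
    let T : Submodule ℝ (TangentSpace 𝓘(ℝ, E) (ι x)) := tangentSub (E' := E') ι x
    let e : TangentSpace 𝓘(ℝ, E') x ≃ₗ[ℝ] T := LinearEquiv.ofInjective D (hinj x)
    let P : TangentSpace 𝓘(ℝ, E) (ι x) →ₗ[ℝ] T := T.orthogonalProjectionOnto.toLinearMap
    let A := e.symm.toLinearMap ∘ₗ P ∘ₗ (J (ι x)).toLinearMap ∘ₗ D
    refine ⟨LinearMap.toContinuousLinearMap A, fun v u ↦ ?_⟩
    have h1 : diffAt (E := E) ι x (A v) = (P (J (ι x) (D v)) : TangentSpace 𝓘(ℝ, E) (ι x)) :=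
      congrArg Subtype.val (e.apply_symm_apply (P (J (ι x) (D v))))
    have h2 : diffAt (E := E) ι x u ∈ T := ⟨u, rfl⟩
    have h3 := T.starProjection_inner_eq_zero (J (ι x) (D v)) _ h2
    rw [inner_sub_left, sub_eq_zero] at h3
    exact (congrArg (fun w ↦ (inner ℝ w (diffAt (E := E) ι x u) : ℝ)) h1).trans h3.symm
  choose F hF using key
  exact ⟨F, hF⟩

theorem IsTangentialPart.sub_mem_normalSub (hF : IsTangentialPart J ι F) (x : N)
    (v : TangentSpace 𝓘(ℝ, E') x) :
    diffAt (E := E) ι x (F x v) - J (ι x) (diffAt (E := E) ι x v) ∈ normalSub (E' := E') ι x := by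
  rw [normalSub, Submodule.mem_orthogonal']
  rintro _ ⟨u, rfl⟩
  have h := hF x v u
  rw [← sub_eq_zero, ← inner_sub_left] at h
  exact h

/-- If v = Ju with u tangent, then Jv = -u is tangent too, so Fv - Jv is both tangent and normal. -/
theorem IsTangentialPart.diffAt_apply (hF : IsTangentialPart J ι F) (hJ : IsKaehler J) {x : N}
    {v : TangentSpace 𝓘(ℝ, E') x}
    (hv : diffAt (E := E) ι x v ∈ holomorphicPart (E' := E') J ι x) :
    diffAt (E := E) ι x (F x v) = J (ι x) (diffAt (E := E) ι x v) := by
  obtain ⟨-, t, ⟨u, rfl⟩, hu⟩ := hv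
  have hu' : J (ι x) (diffAt (E := E) ι x u) = diffAt (E := E) ι x v := hu
  have h1 := hF.sub_mem_normalSub x v
  have h2 : diffAt (E := E) ι x (F x v) - J (ι x) (diffAt (E := E) ι x v) ∈
      tangentSub (E' := E') ι x := by
    refine ⟨F x v + u, ?_⟩
    rw [← hu', hJ.sq_eq_neg, sub_neg_eq_add]
    exact map_add (diffAt (E := E) ι x) _ _
  have h3 : Disjoint (tangentSub (E := E) (E' := E') ι x) (normalSub (E' := E') ι x) :=
    Submodule.orthogonal_disjoint _
  exact sub_eq_zero.1 (Submodule.disjoint_def.1 h3 _ h2 h1)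

/-- If v = Jn with n normal, then Jv = -n has no tangential part. -/
theorem IsTangentialPart.apply_eq_zero (hF : IsTangentialPart J ι F) (hJ : IsKaehler J)
    (hinj : ∀ x, Function.Injective (diffAt (E := E) (E' := E') ι x)) {x : N}
    {v : TangentSpace 𝓘(ℝ, E') x}
    (hv : diffAt (E := E) ι x v ∈ totallyRealPart (E' := E') J ι x) : F x v = 0 := by
  obtain ⟨-, n, hn, hnv⟩ := hv
  have hn' : J (ι x) n = diffAt (E := E) ι x v := hnv
  refine eq_of_inner_diffAt (hinj x) fun u ↦ ?_
  rw [hF x v u, ← hn', hJ.sq_eq_neg, inner_neg_left, map_zero, inner_zero_left, neg_eq_zero]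
  have hu : diffAt (E := E) ι x u ∈ tangentSub (E := E) (E' := E') ι x := ⟨u, rfl⟩
  exact Submodule.inner_left_of_mem_orthogonal hu hn

theorem IsTangentialPart.isInducedFStructure (hF : IsTangentialPart J ι F) (hJ : IsKaehler J)
    (hinj : ∀ x, Function.Injective (diffAt (E := E) (E' := E') ι x)) :
    IsInducedFStructure J ι F :=
  ⟨fun _ _ hv ↦ hF.diffAt_apply hJ hv, fun _ _ hv ↦ hF.apply_eq_zero hJ hinj hv⟩

theorem IsCRSubmanifold.exists_add (hCR : IsCRSubmanifold (E' := E') J ι)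
    (hinj : ∀ x, Function.Injective (diffAt (E := E) (E' := E') ι x)) (x : N)
    (v : TangentSpace 𝓘(ℝ, E') x) : ∃ d k : TangentSpace 𝓘(ℝ, E') x, v = d + k ∧
      diffAt (E := E) ι x d ∈ holomorphicPart (E' := E') J ι x ∧
      diffAt (E := E) ι x k ∈ totallyRealPart (E' := E') J ι x := by
  have hv : diffAt (E := E) ι x v ∈ tangentSub (E := E) (E' := E') ι x := ⟨v, rfl⟩
  rw [← hCR.sup_eq x] at hv
  obtain ⟨a, ha, b, hb, hab⟩ := Submodule.mem_sup.1 hv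
  obtain ⟨d, rfl⟩ := ha.1
  obtain ⟨k, rfl⟩ := hb.1
  refine ⟨d, k, hinj x ?_, ha, hb⟩
  rw [map_add]
  exact hab.symm

theorem IsTangentialPart.apply_mem (hF : IsTangentialPart J ι F) (hJ : IsKaehler J)
    (hinj : ∀ x, Function.Injective (diffAt (E := E) (E' := E') ι x))
    (hCR : IsCRSubmanifold (E' := E') J ι) (x : N) (v : TangentSpace 𝓘(ℝ, E') x) :
    diffAt (E := E) ι x (F x v) ∈ holomorphicPart (E' := E') J ι x := by
  obtain ⟨d, k, rfl, hd, hk⟩ := hCR.exists_add hinj x v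
  rw [map_add, hF.apply_eq_zero hJ hinj hk, add_zero]
  refine ⟨⟨F x d, rfl⟩, ?_⟩
  rw [hF.diffAt_apply hJ hd]
  exact ⟨_, hd.1, rfl⟩

theorem IsTangentialPart.sq_of_mem (hF : IsTangentialPart J ι F) (hJ : IsKaehler J)
    (hinj : ∀ x, Function.Injective (diffAt (E := E) (E' := E') ι x))
    (hCR : IsCRSubmanifold (E' := E') J ι) {x : N} {v : TangentSpace 𝓘(ℝ, E') x}
    (hv : diffAt (E := E) ι x v ∈ holomorphicPart (E' := E') J ι x) : F x (F x v) = -v := by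
  refine hinj x ?_
  rw [hF.diffAt_apply hJ (hF.apply_mem hJ hinj hCR x v), hF.diffAt_apply hJ hv, hJ.sq_eq_neg,
    map_neg]

theorem IsTangentialPart.cube (hF : IsTangentialPart J ι F) (hJ : IsKaehler J)
    (hinj : ∀ x, Function.Injective (diffAt (E := E) (E' := E') ι x))
    (hCR : IsCRSubmanifold (E' := E') J ι) (x : N) (v : TangentSpace 𝓘(ℝ, E') x) :
    F x (F x (F x v)) + F x v = 0 := by
  rw [hF.sq_of_mem hJ hinj hCR (hF.apply_mem hJ hinj hCR x v), neg_add_cancel]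

theorem IsTangentialPart.unique (hF : IsTangentialPart J ι F) (hJ : IsKaehler J)
    (hinj : ∀ x, Function.Injective (diffAt (E := E) (E' := E') ι x))
    (hCR : IsCRSubmanifold (E' := E') J ι) {F' : EndoField E' N}
    (hF' : IsInducedFStructure J ι F') : F' = F := by
  ext x v
  obtain ⟨d, k, rfl, hd, hk⟩ := hCR.exists_add hinj x v
  rw [map_add, map_add, hF.apply_eq_zero hJ hinj hk, hF'.eq_zero x k hk]
  congr 1
  refine hinj x ?_
  rw [hF.diffAt_apply hJ hd, hF'.eq_J x d hd]

/-- The products γ(FX, Z) = γ(JX, Z) are smooth, which suffices by `smoothFieldAt_of_inner`; no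
frame of either distribution is needed. -/
theorem IsTangentialPart.isSmoothEndo (hF : IsTangentialPart J ι F) (hJ : IsKaehler J)
    (hι : IsImmersion 𝓘(ℝ, E') 𝓘(ℝ, E) ∞ ι) : IsSmoothEndo F := by
  intro x X hX
  refine smoothFieldAt_of_inner hι fun Z hZ ↦ ?_
  obtain ⟨X', hX'⟩ := exists_isLocalExtension hι hX
  have h1 : ContMDiffAt 𝓘(ℝ, E') 𝓘(ℝ, E).tangent ∞
      (fun y ↦ (⟨ι y, J (ι y) (X' (ι y))⟩ : TangentBundle 𝓘(ℝ, E) M)) x :=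
    ContMDiffAt.comp x (hJ.smooth _ _ hX'.smooth_ext) hι.contMDiff.contMDiffAt
  have h2 := ContMDiffAt.inner_bundle (IB := 𝓘(ℝ, E)) (F := E)
    (E := fun x : M ↦ TangentSpace 𝓘(ℝ, E) x) (b := ι) h1 (contMDiffAt_along hι.contMDiff hZ)
  refine h2.congr_of_eventuallyEq ?_
  filter_upwards [hX'.related] with y hy
  rw [hF, hy]

end InducedFStructure

/-! ### The shape operator of a totally umbilical submanifold -/

section Umbilical

variable {E : Type*} [NormedAddCommGroup E] [NormedSpace ℝ E] [FiniteDimensional ℝ E]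
  {M : Type*} [TopologicalSpace M] [ChartedSpace E M] [IsManifold 𝓘(ℝ, E) ∞ M]
  [RiemannianBundle (fun x : M ↦ TangentSpace 𝓘(ℝ, E) x)]
  [IsContMDiffRiemannianBundle 𝓘(ℝ, E) ∞ E (fun x : M ↦ TangentSpace 𝓘(ℝ, E) x)]
  {E' : Type*} [NormedAddCommGroup E'] [NormedSpace ℝ E'] [FiniteDimensional ℝ E']
  {N : Type*} [TopologicalSpace N] [ChartedSpace E' N] [IsManifold 𝓘(ℝ, E') ∞ N]
  {J : EndoField E M} {ι : N → M} {F : EndoField E' N}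

theorem IsTotallyGeodesic.isTotallyUmbilical (h : IsTotallyGeodesic E E' ι) :
    IsTotallyUmbilical E E' ι :=
  ⟨fun _ ↦ 0, fun _ ↦ Submodule.zero_mem _, fun x v Y Y' hY ↦ by rw [h x v Y Y' hY, smul_zero]⟩

/-- The shape operator of a totally umbilical submanifold is a multiple of the identity. -/
theorem IsTotallyUmbilical.exists_inner_leviCivita_normal (h : IsTotallyUmbilical E E' ι)
    (hι : IsImmersion 𝓘(ℝ, E') 𝓘(ℝ, E) ∞ ι) (x : N) {n : VField E M}
    (hn : SmoothFieldAt n (ι x)) (hnormal : ∀ᶠ y in 𝓝 x, n (ι y) ∈ normalSub (E' := E') ι y) :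
    ∃ c : ℝ, ∀ v w : TangentSpace 𝓘(ℝ, E') x,
      inner ℝ (diffAt (E := E) ι x w) (leviCivita E M n (ι x) (diffAt (E := E) ι x v)) =
        c * inner ℝ (diffAt (E := E) ι x v) (diffAt (E := E) ι x w) := by
  obtain ⟨η, -, hb⟩ := h
  -- Differentiating γ(W, n) = 0 along N gives γ(W, ∇_v n) = -γ(b(v, W), n) = -γ(v, W) γ(η, n).
  refine ⟨-inner ℝ (η x) (n (ι x)), fun v w ↦ ?_⟩
  obtain ⟨W, hW, rfl⟩ := exists_smoothFieldAt w
  obtain ⟨W', hW'⟩ := exists_isLocalExtension hι hW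
  have h1 := mvfderiv_inner_leviCivita hW'.smooth_ext hn (diffAt (E := E) ι x v)
  have hι1 : MDiffAt ι x := hι.contMDiff.contMDiffAt.mdifferentiableAt (by simp)
  have h0 : (fun p ↦ (inner ℝ (W' p) (n p) : ℝ)) ∘ ι =ᶠ[𝓝 x] fun _ ↦ 0 := by
    filter_upwards [hW'.related, hnormal] with y hy hny
    have hu : diffAt (E := E) ι y (W y) ∈ tangentSub (E := E) (E' := E') ι y := ⟨W y, rfl⟩
    rw [Function.comp_apply, hy]
    exact Submodule.inner_right_of_mem_orthogonal hu hny
  have h2 : mvfderiv 𝓘(ℝ, E) (fun p ↦ (inner ℝ (W' p) (n p) : ℝ)) (ι x) (diffAt (E := E) ι x v) = 0 := by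
    rw [← mvfderiv_comp_apply x (mdiff_inner hW'.smooth_ext.mdiff hn.mdiff) hι1]
    have h3 := h0.mfderiv_eq (I := 𝓘(ℝ, E')) (I' := 𝓘(ℝ, ℝ))
    rw [mfderiv_const] at h3
    exact congrArg (fun L : E' →L[ℝ] ℝ ↦ L v) h3
  have h4 := hb x v W W' hW'
  have h5 : inner ℝ (secondFundamentalForm ι x v W') (n (ι x)) =
      inner ℝ (leviCivita E M W' (ι x) (diffAt (E := E) ι x v)) (n (ι x)) := by
    have : FiniteDimensional ℝ (TangentSpace 𝓘(ℝ, E) (ι x)) :=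
      inferInstanceAs (FiniteDimensional ℝ E)
    have h6 := (normalSub (E' := E') ι x).starProjection_inner_eq_zero
      (leviCivita E M W' (ι x) (diffAt (E := E) ι x v)) _ hnormal.self_of_nhds
    rw [inner_sub_left, sub_eq_zero] at h6
    exact h6.symm
  rw [h4, inner_smul_left] at h5
  rw [h2, ← h5, hW'.related.self_of_nhds] at h1
  simp only [conj_trivial] at h1
  linarith

end Umbilical

/-! ### Bracket identities on a CR-submanifold of a Kähler manifold -/

section KaehlerCRSubmanifold

variable {E : Type*} [NormedAddCommGroup E] [NormedSpace ℝ E] [FiniteDimensional ℝ E]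
  {M : Type*} [TopologicalSpace M] [ChartedSpace E M] [IsManifold 𝓘(ℝ, E) ∞ M]
  [RiemannianBundle (fun x : M ↦ TangentSpace 𝓘(ℝ, E) x)]
  [IsContMDiffRiemannianBundle 𝓘(ℝ, E) ∞ E (fun x : M ↦ TangentSpace 𝓘(ℝ, E) x)]
  {E' : Type*} [NormedAddCommGroup E'] [NormedSpace ℝ E'] [FiniteDimensional ℝ E']
  {N : Type*} [TopologicalSpace N] [ChartedSpace E' N] [IsManifold 𝓘(ℝ, E') ∞ N]
  {J : EndoField E M} {ι : N → M} {F : EndoField E' N}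

theorem IsLocalExtension.diffAt_mlieBracket (hι : IsImmersion 𝓘(ℝ, E') 𝓘(ℝ, E) ∞ ι) {x : N}
    {X Y : VField E' N} {X' Y' : VField E M} (hX : IsLocalExtension ι x X X')
    (hY : IsLocalExtension ι x Y Y') :
    diffAt (E := E) ι x (mlieBracket 𝓘(ℝ, E') X Y x) = mlieBracket 𝓘(ℝ, E) X' Y' (ι x) :=
  mfderiv_mlieBracket_of_related hι.contMDiff.contMDiffAt hX.smooth.mdiff hY.smooth.mdiff
    hX.smooth_ext.mdiff hY.smooth_ext.mdiff hX.related hY.related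

/-- If `X` is a section of the holomorphic distribution and `X'` extends `X`, then `J X'` extends
`F X`. -/
theorem IsTangentialPart.isLocalExtension (hF : IsTangentialPart J ι F) (hJ : IsKaehler J) {x : N}
    {X W : VField E' N} {X' : VField E M} (hX : IsLocalExtension ι x X X')
    (hW : SmoothFieldAt W x)
    (hXW : ∀ᶠ y in 𝓝 x, diffAt (E := E) ι y (X y) ∈ holomorphicPart (E' := E') J ι y ∧
      F y (X y) = W y) :
    IsLocalExtension ι x W (fun p ↦ J p (X' p)) where
  smooth := hW
  smooth_ext := hJ.smooth _ _ hX.smooth_ext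
  related := by
    filter_upwards [hX.related, hXW] with y hy hWy
    rw [hy, ← hWy.2, hF.diffAt_apply hJ hWy.1]

/-- The holomorphic distribution of a CR-submanifold is a CR structure. -/
theorem IsTangentialPart.apply_mlieBracket (hF : IsTangentialPart J ι F) (hJ : IsKaehler J)
    (hι : IsImmersion 𝓘(ℝ, E') 𝓘(ℝ, E) ∞ ι) {x : N} {X W Y V : VField E' N}
    (hX : SmoothFieldAt X x) (hW : SmoothFieldAt W x) (hY : SmoothFieldAt Y x)
    (hV : SmoothFieldAt V x)
    (hXW : ∀ᶠ y in 𝓝 x, diffAt (E := E) ι y (X y) ∈ holomorphicPart (E' := E') J ι y ∧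
      F y (X y) = W y)
    (hYV : ∀ᶠ y in 𝓝 x, diffAt (E := E) ι y (Y y) ∈ holomorphicPart (E' := E') J ι y ∧
      F y (Y y) = V y) :
    diffAt (E := E) ι x (mlieBracket 𝓘(ℝ, E') W Y x + mlieBracket 𝓘(ℝ, E') X V x) ∈
        holomorphicPart (E' := E') J ι x ∧
      F x (mlieBracket 𝓘(ℝ, E') W Y x + mlieBracket 𝓘(ℝ, E') X V x) =
        mlieBracket 𝓘(ℝ, E') W V x - mlieBracket 𝓘(ℝ, E') X Y x := by
  obtain ⟨X', hX'⟩ := exists_isLocalExtension hι hX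
  obtain ⟨Y', hY'⟩ := exists_isLocalExtension hι hY
  have hW' := hF.isLocalExtension hJ hX' hW hXW
  have hV' := hF.isLocalExtension hJ hY' hV hYV
  have hn := hJ.integrable (ι x) X' Y' hX'.smooth_ext hY'.smooth_ext
  -- X', Y', JX' and JY' all extend tangent fields, so every bracket in the Nijenhuis tensor is
  -- tangent to N. Its vanishing reads [W, V] - [X, Y] = J([W, Y] + [X, V]): a tangent vector whose
  -- image under J is tangent, hence a vector of H.
  rw [nijenhuis, ← hW'.diffAt_mlieBracket hι hV', ← hX'.diffAt_mlieBracket hι hY',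
    ← hW'.diffAt_mlieBracket hι hY', ← hX'.diffAt_mlieBracket hι hV', ← map_sub, sub_sub,
    ← map_add (J (ι x)), ← map_add (diffAt (E := E) ι x), sub_eq_zero] at hn
  have hmem : diffAt (E := E) ι x (mlieBracket 𝓘(ℝ, E') W Y x + mlieBracket 𝓘(ℝ, E') X V x) ∈
      holomorphicPart (E' := E') J ι x := by
    refine ⟨⟨_, rfl⟩, -diffAt (E := E) ι x
      (mlieBracket 𝓘(ℝ, E') W V x - mlieBracket 𝓘(ℝ, E') X Y x), ?_, ?_⟩
    · exact Submodule.neg_mem _ ⟨_, rfl⟩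
    · change J (ι x) (-_) = _
      rw [hn, map_neg, hJ.sq_eq_neg, neg_neg]
  refine ⟨hmem, injective_diffAt (E := E) (hι.isImmersionAt x) ?_⟩
  rw [hF.diffAt_apply hJ hmem, hn]

/-- Real part of γ(B, [ξ, FZ] + i[ξ, Z]) = 0 for ξ = W + iX and B = Fb + ib, both of type (1,0). -/
theorem inner_mlieBracket_of_isTotallyUmbilical (hF : IsTangentialPart J ι F) (hJ : IsKaehler J)
    (hι : IsImmersion 𝓘(ℝ, E') 𝓘(ℝ, E) ∞ ι) (hN : IsTotallyUmbilical E E' ι) {x : N}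
    {X W Z : VField E' N} (hX : SmoothFieldAt X x) (hW : SmoothFieldAt W x)
    (hZ : SmoothFieldAt Z x)
    (hXW : ∀ᶠ y in 𝓝 x, diffAt (E := E) ι y (X y) ∈ holomorphicPart (E' := E') J ι y ∧
      F y (X y) = W y) {b : TangentSpace 𝓘(ℝ, E') x}
    (hb : diffAt (E := E) ι x b ∈ holomorphicPart (E' := E') J ι x) :
    (inner ℝ (diffAt (E := E) ι x (F x b))
        (diffAt (E := E) ι x (mlieBracket 𝓘(ℝ, E') W (fun y ↦ F y (Z y)) x
          - mlieBracket 𝓘(ℝ, E') X Z x)) : ℝ) =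
      inner ℝ (diffAt (E := E) ι x b)
        (diffAt (E := E) ι x (mlieBracket 𝓘(ℝ, E') W Z x
          + mlieBracket 𝓘(ℝ, E') X (fun y ↦ F y (Z y)) x)) := by
  obtain ⟨X', hX'⟩ := exists_isLocalExtension hι hX
  obtain ⟨Z', hZ'⟩ := exists_isLocalExtension hι hZ
  obtain ⟨T', hT'⟩ := exists_isLocalExtension hι (hF.isSmoothEndo hJ hι x Z hZ)
  have hW' := hF.isLocalExtension hJ hX' hW hXW
  have hJZ : SmoothFieldAt (fun p ↦ J p (Z' p)) (ι x) := hJ.smooth _ _ hZ'.smooth_ext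
  -- Along N this field is FZ - JZ, minus the normal part of JZ. Since J is parallel, its derivative
  -- is ∇T' - J∇Z'.
  have hn : SmoothFieldAt (T' + (-1 : ℝ) • fun p ↦ J p (Z' p) : VField E M) (ι x) :=
    ContMDiffAt.add_section hT'.smooth_ext hJZ.const_smul_section
  have hnormal : ∀ᶠ y in 𝓝 x, (T' + (-1 : ℝ) • fun p ↦ J p (Z' p) : VField E M) (ι y) ∈
      normalSub (E' := E') ι y := by
    filter_upwards [hT'.related, hZ'.related] with y hy hzy
    have := hF.sub_mem_normalSub y (Z y)
    rw [Pi.add_apply, Pi.smul_apply, hy, hzy, neg_one_smul, ← sub_eq_add_neg]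
    exact this
  obtain ⟨c, hc⟩ := hN.exists_inner_leviCivita_normal hι x hn hnormal
  have hcov : ∀ v, leviCivita E M (T' + (-1 : ℝ) • fun p ↦ J p (Z' p) : VField E M) (ι x) v =
      leviCivita E M T' (ι x) v - J (ι x) (leviCivita E M Z' (ι x) v) := by
    intro v
    have h1 := (leviCivita E M).isCovariantDerivativeOnUniv.add hT'.smooth_ext.mdiff
      (SmoothFieldAt.mdiff (ContMDiffAt.const_smul_section (a := (-1 : ℝ)) hJZ))
    have h2 := (leviCivita E M).isCovariantDerivativeOnUniv.smul_const (-1 : ℝ) hJZ.mdiff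
    rw [← hJ.leviCivita_apply hZ'.smooth_ext, h1, h2, neg_one_smul, sub_eq_add_neg]
    rfl
  have hXx := hXW.self_of_nhds
  -- The right-hand sides cγ(X, b) and cγ(FX, Fb) coincide because J is orthogonal and agrees with F
  -- on H; the unknown c is thus eliminated.
  have c1 := hc (X x) b
  have c2 := hc (W x) (F x b)
  rw [← hXx.2] at c2
  rw [map_sub, map_add, hW'.diffAt_mlieBracket hι hT', hX'.diffAt_mlieBracket hι hZ',
    hW'.diffAt_mlieBracket hι hZ', hX'.diffAt_mlieBracket hι hT',
    mlieBracket_eq_leviCivita hW'.smooth_ext hT'.smooth_ext,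
    mlieBracket_eq_leviCivita hX'.smooth_ext hZ'.smooth_ext,
    mlieBracket_eq_leviCivita hW'.smooth_ext hZ'.smooth_ext,
    mlieBracket_eq_leviCivita hX'.smooth_ext hT'.smooth_ext]
  simp only [hJ.leviCivita_apply hX'.smooth_ext, hX'.related.self_of_nhds]
  rw [hcov, hF.diffAt_apply hJ hXx.1, hF.diffAt_apply hJ hb, hJ.orthogonal] at c2
  rw [hcov] at c1
  rw [hF.diffAt_apply hJ hb]
  simp only [inner_sub_right, inner_add_right, hJ.orthogonal] at c1 c2 ⊢
  have e : ∀ v, inner ℝ (J (ι x) (diffAt (E := E) ι x b)) v =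
    -inner ℝ (diffAt (E := E) ι x b) (J (ι x) v) := fun v ↦ hJ.inner_left _ _ _
  linarith [e (leviCivita E M Z' (ι x) (diffAt (E := E) ι x (X x))),
    e (leviCivita E M X' (ι x) (Z' (ι x)))]

end KaehlerCRSubmanifold

/-! ### Closure of the eigenbundle under the Courant bracket -/

section Main

variable {E : Type*} [NormedAddCommGroup E] [NormedSpace ℝ E] [FiniteDimensional ℝ E]
  {M : Type*} [TopologicalSpace M] [ChartedSpace E M] [IsManifold 𝓘(ℝ, E) ∞ M]
  [RiemannianBundle (fun x : M ↦ TangentSpace 𝓘(ℝ, E) x)]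
  [IsContMDiffRiemannianBundle 𝓘(ℝ, E) ∞ E (fun x : M ↦ TangentSpace 𝓘(ℝ, E) x)]
  {E' : Type*} [NormedAddCommGroup E'] [NormedSpace ℝ E'] [FiniteDimensional ℝ E']
  {N : Type*} [TopologicalSpace N] [ChartedSpace E' N] [IsManifold 𝓘(ℝ, E') ∞ N]
  {J : EndoField E M} {ι : N → M} {F : EndoField E' N}

/-- Covectors are represented by tangent vectors via the induced metric. -/
theorem exists_inner_eq_covec {x : N} (h : Function.Injective (diffAt (E := E) (E' := E') ι x))
    (β : Covec E' x) : ∃ b : TangentSpace 𝓘(ℝ, E') x, ∀ v : TangentSpace 𝓘(ℝ, E') x,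
      β v = inner ℝ (diffAt (E := E) ι x b) (diffAt (E := E) ι x v) := by
  have : FiniteDimensional ℝ (TangentSpace 𝓘(ℝ, E') x) :=
    inferInstanceAs (FiniteDimensional ℝ E')
  let L : TangentSpace 𝓘(ℝ, E') x →ₗ[ℝ] Module.Dual ℝ (TangentSpace 𝓘(ℝ, E') x) :=
    LinearMap.mk₂ ℝ (fun b v ↦ (inner ℝ (diffAt (E := E) ι x b) (diffAt (E := E) ι x v) : ℝ))
      (fun _ _ _ ↦ by rw [map_add, inner_add_left])
      (fun _ _ _ ↦ by rw [map_smul, real_inner_smul_left, smul_eq_mul])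
      (fun _ _ _ ↦ by rw [map_add, inner_add_right])
      (fun _ _ _ ↦ by rw [map_smul, real_inner_smul_right, smul_eq_mul])
  have hL : Function.Injective L := fun v w hvw ↦
    eq_of_inner_diffAt h fun u ↦ LinearMap.congr_fun hvw u
  obtain ⟨b, hb⟩ := (LinearMap.injective_iff_surjective_of_finrank_eq_finrank
    Subspace.dual_finrank_eq.symm).1 hL β.toLinearMap
  exact ⟨b, fun v ↦ (LinearMap.congr_fun hb v).symm⟩

theorem IsTangentialPart.inner_left (hF : IsTangentialPart J ι F) (hJ : IsKaehler J) (x : N)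
    (v u : TangentSpace 𝓘(ℝ, E') x) :
    (inner ℝ (diffAt (E := E) ι x (F x v)) (diffAt (E := E) ι x u) : ℝ) =
      -inner ℝ (diffAt (E := E) ι x v) (diffAt (E := E) ι x (F x u)) := by
  rw [hF, hJ.inner_left, real_inner_comm, ← hF, real_inner_comm]

/-- `X₁ + i X₂` is an `i`-eigenvector of `F` at each point near `x`. -/
structure IsEigenField (F : EndoField E' N) (X₁ X₂ : VField E' N) (x : N) : Prop where
  smooth_re : SmoothFieldAt X₁ x
  smooth_im : SmoothFieldAt X₂ x
  apply_re : ∀ᶠ y in 𝓝 x, F y (X₁ y) = -X₂ y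
  apply_im : ∀ᶠ y in 𝓝 x, F y (X₂ y) = X₁ y

/-- `β₁ + i β₂` is an `i`-eigenvector of `-Fᵗ` at each point near `x`. -/
structure IsEigenForm (F : EndoField E' N) (β₁ β₂ : (x : N) → Covec E' x) (x : N) : Prop where
  smooth_re : SmoothFormAt β₁ x
  smooth_im : SmoothFormAt β₂ x
  apply_re : ∀ᶠ y in 𝓝 x, ∀ v, β₁ y (F y v) = β₂ y v
  apply_im : ∀ᶠ y in 𝓝 x, ∀ v, β₂ y (F y v) = -β₁ y v

theorem IsTangentialPart.mem_of_isEigenField (hF : IsTangentialPart J ι F) (hJ : IsKaehler J)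
    (hι : IsImmersion 𝓘(ℝ, E') 𝓘(ℝ, E) ∞ ι) (hCR : IsCRSubmanifold (E' := E') J ι) {x : N}
    {X₁ X₂ : VField E' N} (hX : IsEigenField F X₁ X₂ x) :
    ∀ᶠ y in 𝓝 x, diffAt (E := E) ι y (X₂ y) ∈ holomorphicPart (E' := E') J ι y ∧
      F y (X₂ y) = X₁ y := by
  filter_upwards [hX.apply_re, hX.apply_im] with y h1 h2
  refine ⟨?_, h2⟩
  rw [← neg_neg (X₂ y), ← h1, ← map_neg]
  exact hF.apply_mem hJ (fun x ↦ injective_diffAt (hι.isImmersionAt x)) hCR y _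

/-- Real part of β([X, FZ] + i[X, Z]) = 0, the obstruction to L_Xβ being an eigenform. -/
theorem eigenForm_mlieBracket (hF : IsTangentialPart J ι F) (hJ : IsKaehler J)
    (hι : IsImmersion 𝓘(ℝ, E') 𝓘(ℝ, E) ∞ ι) (hCR : IsCRSubmanifold (E' := E') J ι)
    (hN : IsTotallyUmbilical E E' ι) {x : N} {X₁ X₂ Z : VField E' N}
    (hX : IsEigenField F X₁ X₂ x) (hZ : SmoothFieldAt Z x) {β₁ β₂ : Covec E' x}
    (h1 : ∀ v, β₁ (F x v) = β₂ v) (h2 : ∀ v, β₂ (F x v) = -β₁ v) :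
    β₁ (mlieBracket 𝓘(ℝ, E') X₁ (fun y ↦ F y (Z y)) x) - β₁ (mlieBracket 𝓘(ℝ, E') X₂ Z x) =
      β₂ (mlieBracket 𝓘(ℝ, E') X₁ Z x) + β₂ (mlieBracket 𝓘(ℝ, E') X₂ (fun y ↦ F y (Z y)) x) := by
  have hinj : ∀ x, Function.Injective (diffAt (E := E) (E' := E') ι x) :=
    fun x ↦ injective_diffAt (hι.isImmersionAt x)
  -- If b represents the imaginary part of β, skewness of F makes Fb represent the real part. The
  -- eigenvalue equations then force F²b = -b, so b lies in H.
  obtain ⟨b, hb⟩ := exists_inner_eq_covec (hinj x) β₂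
  have hb1 : ∀ v, β₁ v = inner ℝ (diffAt (E := E) ι x (F x b)) (diffAt (E := E) ι x v) := fun v ↦ by
    rw [hF.inner_left hJ, ← hb, h2, neg_neg]
  have hFb : F x (F x b) = -b := by
    refine eq_of_inner_diffAt (hinj x) fun u ↦ ?_
    rw [hF.inner_left hJ, ← hb1, h1, hb, map_neg, inner_neg_left]
  have hmem : diffAt (E := E) ι x b ∈ holomorphicPart (E' := E') J ι x := by
    rw [← neg_neg b, ← hFb, ← map_neg]
    exact hF.apply_mem hJ hinj hCR x _
  have h := inner_mlieBracket_of_isTotallyUmbilical hF hJ hι hN hX.smooth_im hX.smooth_re hZ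
    (hF.mem_of_isEigenField hJ hι hCR hX) hmem
  rwa [← hb, ← hb1, map_sub, map_add] at h

/-- Real and imaginary parts of (L_Xβ)∘F = -i L_Xβ. Since β(FZ) = -iβ(Z) near the point, the
derivative terms cancel and only the bracket terms remain. -/
theorem lieDerivForm_eigen (hF : IsTangentialPart J ι F) (hJ : IsKaehler J)
    (hι : IsImmersion 𝓘(ℝ, E') 𝓘(ℝ, E) ∞ ι) (hCR : IsCRSubmanifold (E' := E') J ι)
    (hN : IsTotallyUmbilical E E' ι) {x : N} {X₁ X₂ : VField E' N}
    {β₁ β₂ : (x : N) → Covec E' x}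
    (hX : IsEigenField F X₁ X₂ x) (hβ : IsEigenForm F β₁ β₂ x) (v : TangentSpace 𝓘(ℝ, E') x) :
    (lieDerivForm X₁ β₁ x - lieDerivForm X₂ β₂ x) (F x v) =
        (lieDerivForm X₁ β₂ x + lieDerivForm X₂ β₁ x) v ∧
      (lieDerivForm X₁ β₂ x + lieDerivForm X₂ β₁ x) (F x v) =
        -(lieDerivForm X₁ β₁ x - lieDerivForm X₂ β₂ x) v := by
  obtain ⟨Z, hZ, rfl⟩ := exists_smoothFieldAt v
  have hFZ := hF.isSmoothEndo hJ hι x Z hZ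
  have e1 : (fun y ↦ β₁ y (F y (Z y))) =ᶠ[𝓝 x] fun y ↦ β₂ y (Z y) :=
    hβ.apply_re.mono fun y hy ↦ hy _
  have e2 : (fun y ↦ β₂ y (F y (Z y))) =ᶠ[𝓝 x] -fun y ↦ β₁ y (Z y) :=
    hβ.apply_im.mono fun y hy ↦ hy _
  have d1 : mvfderiv 𝓘(ℝ, E') (fun y ↦ β₁ y (F y (Z y))) x =
      mvfderiv 𝓘(ℝ, E') (fun y ↦ β₂ y (Z y)) x := e1.mfderiv_eq
  have d2 : mvfderiv 𝓘(ℝ, E') (fun y ↦ β₂ y (F y (Z y))) x =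
      -mvfderiv 𝓘(ℝ, E') (fun y ↦ β₁ y (Z y)) x := by
    rw [← mvfderiv_neg]; exact e2.mfderiv_eq
  have k1 := eigenForm_mlieBracket hF hJ hι hCR hN hX hZ hβ.apply_re.self_of_nhds
    hβ.apply_im.self_of_nhds
  -- The imaginary part of the identity for β is its real part for -iβ = β₂ - iβ₁.
  have k2 := eigenForm_mlieBracket (β₁ := β₂ x) (β₂ := -β₁ x) hF hJ hι hCR hN hX hZ
    (fun v ↦ hβ.apply_im.self_of_nhds v)
    (fun v ↦ congrArg Neg.neg (hβ.apply_re.self_of_nhds v))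
  simp only [neg_apply] at k2
  have l1 := fun X : VField E' N ↦ lieDerivForm_apply (X := X) hβ.smooth_re hZ
  have l2 := fun X : VField E' N ↦ lieDerivForm_apply (X := X) hβ.smooth_im hZ
  have m1 := fun X : VField E' N ↦ lieDerivForm_apply (X := X) hβ.smooth_re hFZ
  have m2 := fun X : VField E' N ↦ lieDerivForm_apply (X := X) hβ.smooth_im hFZ
  simp only [d1, d2, neg_apply] at m1 m2
  simp only [sub_apply, add_apply, l1, l2, m1, m2]
  constructor <;> linarith

theorem mvfderiv_congr {f g : N → ℝ} {x : N} (h : f =ᶠ[𝓝 x] g) :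
    mvfderiv 𝓘(ℝ, E') f x = mvfderiv 𝓘(ℝ, E') g x :=
  h.mfderiv_eq

theorem isGeneralizedCRF_bigOfEndo (hF : IsTangentialPart J ι F) (hJ : IsKaehler J)
    (hι : IsImmersion 𝓘(ℝ, E') 𝓘(ℝ, E) ∞ ι) (hCR : IsCRSubmanifold (E' := E') J ι)
    (hN : IsTotallyUmbilical E E' ι) : IsGeneralizedCRF (bigOfEndo F) := by
  have hinj : ∀ x, Function.Injective (diffAt (E := E) (E' := E') ι x) :=
    fun x ↦ injective_diffAt (hι.isImmersionAt x)
  have hcube := hF.cube hJ hinj hCR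
  refine ⟨⟨fun x s hs ↦ ⟨hF.isSmoothEndo hJ hι x _ hs.1, fun Z hZ ↦ ?_⟩, fun x s ↦ ?_,
    fun x s t ↦ ?_⟩, ?_⟩
  · exact (hs.2 _ (hF.isSmoothEndo hJ hι x Z hZ)).neg
  · refine Prod.ext (hcube x s.1) (ContinuousLinearMap.ext fun v ↦ ?_)
    have h := congrArg s.2 (hcube x v)
    simp [bigOfEndo] at h ⊢
    linarith
  · simp [bigOfEndo, pairing]
    ring
  · intro U hU a b c d hs he x hx
    have hUx := hU.mem_nhds hx
    have key : ∀ s t : BigSection E' N, (∀ x ∈ U, SmoothBigAt s x ∧ SmoothBigAt t x) →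
        (∀ x ∈ U, MemEigen (bigOfEndo F) x (s x) (t x)) →
        IsEigenField F (fun y ↦ (s y).1) (fun y ↦ (t y).1) x ∧
          IsEigenForm F (fun y ↦ (s y).2) (fun y ↦ (t y).2) x := by
      intro s t hst hest
      refine ⟨⟨(hst x hx).1.1, (hst x hx).2.1, ?_, ?_⟩, ⟨(hst x hx).1.2, (hst x hx).2.2, ?_, ?_⟩⟩
      · filter_upwards [hUx] with y hy using congrArg Prod.fst (hest y hy).1
      · filter_upwards [hUx] with y hy using congrArg Prod.fst (hest y hy).2
      · filter_upwards [hUx] with y hy v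
        have := congrArg (fun p : BigTangent E' y ↦ p.2 v) (hest y hy).1
        exact neg_injective this
      · filter_upwards [hUx] with y hy v
        have := congrArg (fun p : BigTangent E' y ↦ p.2 v) (hest y hy).2
        exact neg_eq_iff_eq_neg.1 this
    obtain ⟨hX, hα⟩ := key a b (fun y hy ↦ ⟨(hs y hy).1, (hs y hy).2.1⟩) fun y hy ↦ (he y hy).1
    obtain ⟨hY, hβ⟩ := key c d (fun y hy ↦ ⟨(hs y hy).2.2.1, (hs y hy).2.2.2⟩)
      fun y hy ↦ (he y hy).2
    have hbr := (hF.apply_mlieBracket hJ hι hX.smooth_im hX.smooth_re hY.smooth_im hY.smooth_re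
      (hF.mem_of_isEigenField hJ hι hCR hX) (hF.mem_of_isEigenField hJ hι hCR hY))
    -- The imaginary part of [X, Y] lies in H and F maps it to the real part; F² = -1 on H then
    -- gives the other eigenvalue equation.
    have hsq := hF.sq_of_mem hJ hinj hCR hbr.1
    have hl := lieDerivForm_eigen hF hJ hι hCR hN hX hβ
    have hl' := lieDerivForm_eigen hF hJ hι hCR hN hY hα
    -- `d1` and `d2` say that the real and imaginary parts of d(α(Y) - β(X)) vanish: moving F from a
    -- form to a vector gives α(Y) and β(X) opposite eigenvalues.
    have d1 : mvfderiv 𝓘(ℝ, E') (fun y ↦ (a y).2 (c y).1 - (c y).2 (a y).1) x =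
        mvfderiv 𝓘(ℝ, E') (fun y ↦ (b y).2 (d y).1 - (d y).2 (b y).1) x := by
      refine mvfderiv_congr ?_
      filter_upwards [hα.apply_re, hY.apply_im, hβ.apply_re, hX.apply_im] with y h1 h2 h3 h4
      rw [← h1, h2, ← h3, h4]
    have d2 : mvfderiv 𝓘(ℝ, E') (fun y ↦ (a y).2 (d y).1 - (d y).2 (a y).1) x =
        -mvfderiv 𝓘(ℝ, E') (fun y ↦ (b y).2 (c y).1 - (c y).2 (b y).1) x := by
      rw [← mvfderiv_neg]
      refine mvfderiv_congr ?_
      filter_upwards [hα.apply_im, hY.apply_im, hβ.apply_im, hX.apply_im] with y h1 h2 h3 h4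
      rw [Pi.neg_apply, ← h2, ← h4, h1, h3]
      ring
    have f1 : (courantBracket a c x - courantBracket b d x).2 =
        (lieDerivForm (fun y ↦ (a y).1) (fun y ↦ (c y).2) x
          - lieDerivForm (fun y ↦ (b y).1) (fun y ↦ (d y).2) x)
        - (lieDerivForm (fun y ↦ (c y).1) (fun y ↦ (a y).2) x
          - lieDerivForm (fun y ↦ (d y).1) (fun y ↦ (b y).2) x) := by
      simp only [courantBracket, Prod.snd_sub, d1]
      abel
    have f2 : (courantBracket a d x + courantBracket b c x).2 =
        (lieDerivForm (fun y ↦ (a y).1) (fun y ↦ (d y).2) x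
          + lieDerivForm (fun y ↦ (b y).1) (fun y ↦ (c y).2) x)
        - (lieDerivForm (fun y ↦ (c y).1) (fun y ↦ (b y).2) x
          + lieDerivForm (fun y ↦ (d y).1) (fun y ↦ (a y).2) x) := by
      simp only [courantBracket, Prod.snd_add, d2, smul_neg]
      abel
    refine ⟨Prod.ext ?_ (ContinuousLinearMap.ext fun v ↦ ?_),
      Prod.ext hbr.2 (ContinuousLinearMap.ext fun v ↦ ?_)⟩
    · rw [hbr.2] at hsq
      exact hsq
    · change -(courantBracket a c x - courantBracket b d x).2 (F x v) =
        -(courantBracket a d x + courantBracket b c x).2 v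
      rw [f1, f2, sub_apply, sub_apply _ _ v, (hl v).1, (hl' v).1]
    · change -(courantBracket a d x + courantBracket b c x).2 (F x v) =
        (courantBracket a c x - courantBracket b d x).2 v
      rw [f1, f2, sub_apply, sub_apply _ _ v, (hl v).2, (hl' v).2]
      ring

end Main

end

theorem corollary3p1
    {E : Type*} [NormedAddCommGroup E] [NormedSpace ℝ E] [FiniteDimensional ℝ E]
    {M : Type*} [TopologicalSpace M] [ChartedSpace E M] [IsManifold 𝓘(ℝ, E) ∞ M]
    [RiemannianBundle (fun x : M ↦ TangentSpace 𝓘(ℝ, E) x)]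
    [IsContMDiffRiemannianBundle 𝓘(ℝ, E) ∞ E (fun x : M ↦ TangentSpace 𝓘(ℝ, E) x)]
    (J : EndoField E M) (hJ : IsKaehler J)
    {E' : Type*} [NormedAddCommGroup E'] [NormedSpace ℝ E'] [FiniteDimensional ℝ E']
    {N : Type*} [TopologicalSpace N] [ChartedSpace E' N] [IsManifold 𝓘(ℝ, E') ∞ N]
    (ι : N → M) (hι : IsImmersion 𝓘(ℝ, E') 𝓘(ℝ, E) ∞ ι)
    (hCR : IsCRSubmanifold (E' := E') J ι)
    (hN : IsTotallyUmbilical E E' ι ∨ IsTotallyGeodesic E E' ι) :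
    ∃ F : EndoField E' N, IsInducedFStructure J ι F ∧
      (∀ F' : EndoField E' N, IsInducedFStructure J ι F' → F' = F) ∧ IsClassicalCRF F := by

  have hinj : ∀ x, Function.Injective (diffAt (E := E) (E' := E') ι x) :=
    fun x ↦ injective_diffAt (hι.isImmersionAt x)
  have hN' : IsTotallyUmbilical E E' ι := hN.elim id fun h ↦ h.isTotallyUmbilical
  obtain ⟨F, hF⟩ := exists_isTangentialPart J hinj
  exact ⟨F, hF.isInducedFStructure hJ hinj, fun F' hF' ↦ hF.unique hJ hinj hCR hF',
    hF.isSmoothEndo hJ hι, hF.cube hJ hinj hCR, isGeneralizedCRF_bigOfEndo hF hJ hι hCR hN'⟩
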